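/- Let $\mathsf{RCA}_0$ be the function-based second order system with classical logic whose variables range over natural numbers (type $0$) and functions from $\mathbb N$ to $\mathbb N$ (type $1$). Its terms are built from $0$, successor, $+$, $\cdot$, function application, $\lambda$-abstraction over number variables, and primitive recursion of type $0$. Its axioms are those of equality on numbers; extensionality; the basic arithmetical axioms; the defining equations of $\lambda$-abstraction and primitive recursion; induction for quantifier-free formulas; and the quantifier-free choice scheme $\mathsf{QF}\text{-}\mathsf{AC}^{0,0}$, $\forall x\,\exists y\,A_0(x,y)\to\exists f\,\forall x\,A_0(x,f(x))$ (in all schemes parameters of both types are allowed). Within $\mathsf{RCA}_0$, a real number is a sequence $f$ of (coded) rationals with $|f(k)-f(k+i)|\le 2^{-k}$ for all $k,i$; two real numbers $f,g$ are equal if $|f(k)-g(k)|\le 2\cdot 2^{-k}$ for all $k$; and a complex number is a pair of real numbers. Then $\mathsf{RCA}_0$ proves the sentence stating: for every $2\times 2$ matrix $M$ of complex numbers there are $2\times2$ matrices $U$, $J$ of complex numbers such that $U$ is invertible, $M=UJU^{-1}$, and $J$ consists of Jordan blocks, that is, $J=\begin{pmatrix}\lambda&0\\0&\mu\end{pmatrix}$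 or $J=\begin{pmatrix}\lambda&1\\0&\lambda\end{pmatrix}$ for some complex $\lambda,\mu$. -/

import Mathlib

/-! The function-based second order system `RCA₀` and its language, and the sentence of that language
saying that every `2 × 2` complex matrix has a Jordan decomposition. -/

namespace RCA

/-! ### Language

Two sorts: natural numbers (type `0`) and functions from numbers to numbers (type `1 = 0 → 0`).
Variables are de Bruijn indices, counted separately for the two sorts: a binder for a variable of
sort `s` captures index `0` of sort `s`, raises the other indices of sort `s` by one, and leaves the
indices of the other sort alone. -/

/-- The two sorts of variables: type `0` and type `1`. -/
inductive Srt where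
  | num
  | fn

/-- Terms of type `0` and of type `1`. -/
inductive Term : Srt → Type where
  /-- the variable of sort `s` with index `i` -/
  | var (s : Srt) (i : ℕ) : Term s
  | zero : Term .num
  | succ (t : Term .num) : Term .num
  | add (t u : Term .num) : Term .num
  | mul (t u : Term .num) : Term .num
  /-- the value of the function `f` at `t` -/
  | app (f : Term .fn) (t : Term .num) : Term .num
  /-- `λ x. t`; the variable `x` is number variable `0` in `t` -/
  | lam (t : Term .num) : Term .fn
  /-- Primitive recursion of type `0`: `prec a b t` is the value `R(t)`, where `R(0) = a` and
  `R(n + 1) = b(R(n), n)`; in `b` the value `R(n)` is number variable `0` and the counter `n` is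
  number variable `1`. -/
  | prec (a b t : Term .num) : Term .num

/-- The number variable with index `i`. -/
abbrev Term.nv (i : ℕ) : Term .num := .var .num i

/-- The function variable with index `i`. -/
abbrev Term.fv (i : ℕ) : Term .fn := .var .fn i

/-- Renamings of variables. -/
abbrev Ren : Type := Srt → ℕ → ℕ

/-- The renaming that makes room for a new variable of the given sort. -/
def Ren.shift : Srt → Ren
  | .num, .num, i => i + 1
  | .num, .fn, i => i
  | .fn, .num, i => i
  | .fn, .fn, i => i + 1

/-- A renaming, carried under a binder of the given sort. -/
def Ren.up (ρ : Ren) : Srt → Ren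
  | .num, .num, 0 => 0
  | .num, .num, i + 1 => ρ .num i + 1
  | .num, .fn, i => ρ .fn i
  | .fn, .num, i => ρ .num i
  | .fn, .fn, 0 => 0
  | .fn, .fn, i + 1 => ρ .fn i + 1

/-- Renaming the variables of a term. -/
def Term.rename : {s : Srt} → Term s → Ren → Term s
  | _, .var s i, ρ => .var s (ρ s i)
  | _, .zero, _ => .zero
  | _, .succ t, ρ => .succ (t.rename ρ)
  | _, .add t u, ρ => .add (t.rename ρ) (u.rename ρ)
  | _, .mul t u, ρ => .mul (t.rename ρ) (u.rename ρ)
  | _, .app f t, ρ => .app (f.rename ρ) (t.rename ρ)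
  | _, .lam t, ρ => .lam (t.rename (ρ.up .num))
  | _, .prec a b t, ρ =>
      .prec (a.rename ρ) (b.rename ((ρ.up .num).up .num)) (t.rename ρ)

/-- A term, moved under a binder of sort `r`. -/
def Term.lift {s : Srt} (t : Term s) (r : Srt) : Term s := t.rename (Ren.shift r)

/-- Simultaneous substitutions. -/
abbrev Sub : Type := (s : Srt) → ℕ → Term s

/-- A substitution, carried under a binder of the given sort. -/
def Sub.up (σ : Sub) : Srt → Sub
  | .num, .num, 0 => .nv 0
  | .num, .num, i + 1 => (σ .num i).lift .num
  | .num, .fn, i => (σ .fn i).lift .num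
  | .fn, .num, i => (σ .num i).lift .fn
  | .fn, .fn, 0 => .fv 0
  | .fn, .fn, i + 1 => (σ .fn i).lift .fn

/-- Capture-avoiding substitution in a term. -/
def Term.subst : {s : Srt} → Term s → Sub → Term s
  | _, .var s i, σ => σ s i
  | _, .zero, _ => .zero
  | _, .succ t, σ => .succ (t.subst σ)
  | _, .add t u, σ => .add (t.subst σ) (u.subst σ)
  | _, .mul t u, σ => .mul (t.subst σ) (u.subst σ)
  | _, .app f t, σ => .app (f.subst σ) (t.subst σ)
  | _, .lam t, σ => .lam (t.subst (σ.up .num))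
  | _, .prec a b t, σ =>
      .prec (a.subst σ) (b.subst ((σ.up .num).up .num)) (t.subst σ)

/-- Replace variable `0` of the sort of `t` by `t`, and lower the other variables of this sort. -/
def Sub.single : {s : Srt} → Term s → Sub
  | .num, t, .num, 0 => t
  | .num, _, .num, i + 1 => .nv i
  | .num, _, .fn, i => .fv i
  | .fn, _, .num, i => .nv i
  | .fn, t, .fn, 0 => t
  | .fn, _, .fn, i + 1 => .fv i

/-- Replace number variables `0` and `1` by `t` and `u`, and lower the others by two. -/
def Sub.double (t u : Term .num) : Sub
  | .num, 0 => t
  | .num, 1 => u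
  | .num, i + 2 => .nv i
  | .fn, i => .fv i

/-- Replace number variable `0` by its successor. -/
def Sub.next : Sub
  | .num, 0 => .succ (.nv 0)
  | .num, i + 1 => .nv (i + 1)
  | .fn, i => .fv i

/-- Turns `φ(y, x)`, with `y` and `x` number variables `0` and `1`, into `φ(f(x), x)`, with `x` number
variable `0` and `f` function variable `0`. -/
def Sub.choice : Sub
  | .num, 0 => .app (.fv 0) (.nv 0)
  | .num, i + 1 => .nv i
  | .fn, i => .fv (i + 1)

/-- Formulas. The only primitive relation is equality of numbers. The logic is classical, so the
remaining connectives are abbreviations. -/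
inductive Formula : Type where
  | eq (t u : Term .num) : Formula
  | falsum : Formula
  | imp (φ ψ : Formula) : Formula
  /-- universal quantification over variable `0` of sort `s` -/
  | all (s : Srt) (φ : Formula) : Formula

namespace Formula

/-- `¬ φ` -/
def neg (φ : Formula) : Formula := φ.imp falsum

/-- `φ ∧ ψ` -/
def and (φ ψ : Formula) : Formula := (φ.imp ψ.neg).neg

/-- `φ ∨ ψ` -/
def or (φ ψ : Formula) : Formula := φ.neg.imp ψ

/-- Existential quantification over variable `0` of sort `s`. -/
def ex (s : Srt) (φ : Formula) : Formula := (all s φ.neg).neg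

/-- Capture-avoiding substitution in a formula. -/
def subst : Formula → Sub → Formula
  | eq t u, σ => eq (t.subst σ) (u.subst σ)
  | falsum, _ => falsum
  | imp φ ψ, σ => imp (φ.subst σ) (ψ.subst σ)
  | all s φ, σ => all s (φ.subst (σ.up s))

/-- A formula, moved under a binder of sort `s`. -/
def lift (φ : Formula) (s : Srt) : Formula := φ.subst fun r i => .var r (Ren.shift s r i)

/-- `φ(t)`, where `φ = φ(x)` and `x` is variable `0` of the sort of `t`. -/
def inst {s : Srt} (φ : Formula) (t : Term s) : Formula := φ.subst (Sub.single t)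

/-- Quantifier-free formulas (with arbitrary terms). -/
def QuantifierFree : Formula → Prop
  | eq _ _ => True
  | falsum => True
  | imp φ ψ => φ.QuantifierFree ∧ ψ.QuantifierFree
  | all _ _ => False

end Formula

open Term Formula

/-! ### Derivations -/

/-- Natural deduction for two-sorted classical predicate logic with equality of numbers, over the
axioms `T` (read as universally closed): `Deriv T Γ φ` says that `φ` is derivable from `T` and the
hypotheses `Γ`. -/
inductive Deriv (T : Formula → Prop) : List Formula → Formula → Prop where
  | ax {Γ : List Formula} {φ : Formula} : T φ → Deriv T Γ φ
  | hyp {Γ : List Formula} {φ : Formula} : φ ∈ Γ → Deriv T Γ φ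
  | impI {Γ : List Formula} {φ ψ : Formula} : Deriv T (φ :: Γ) ψ → Deriv T Γ (φ.imp ψ)
  | impE {Γ : List Formula} {φ ψ : Formula} : Deriv T Γ (φ.imp ψ) → Deriv T Γ φ → Deriv T Γ ψ
  /-- classical reductio ad absurdum -/
  | raa {Γ : List Formula} {φ : Formula} : Deriv T (φ.neg :: Γ) falsum → Deriv T Γ φ
  | allI {Γ : List Formula} {s : Srt} {φ : Formula} :
      Deriv T (Γ.map fun ψ => ψ.lift s) φ → Deriv T Γ (all s φ)
  | allE {Γ : List Formula} {s : Srt} {φ : Formula} (t : Term s) :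
      Deriv T Γ (all s φ) → Deriv T Γ (φ.inst t)
  | eqRefl {Γ : List Formula} (t : Term .num) : Deriv T Γ (eq t t)
  | eqSubst {Γ : List Formula} (φ : Formula) {t u : Term .num} :
      Deriv T Γ (eq t u) → Deriv T Γ (φ.inst t) → Deriv T Γ (φ.inst u)

/-- The (nonlogical) axioms of `RCA₀`. Free variables are parameters. -/
inductive RCA₀ : Formula → Prop where
  | succ_ne_zero (t : Term .num) : RCA₀ (neg (eq (succ t) zero))
  | succ_inj (t u : Term .num) : RCA₀ (imp (eq (succ t) (succ u)) (eq t u))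
  | add_zero (t : Term .num) : RCA₀ (eq (add t zero) t)
  | add_succ (t u : Term .num) : RCA₀ (eq (add t (succ u)) (succ (add t u)))
  | mul_zero (t : Term .num) : RCA₀ (eq (mul t zero) zero)
  | mul_succ (t u : Term .num) : RCA₀ (eq (mul t (succ u)) (add (mul t u) t))
  /-- `(λ x. t(x))(u) = t(u)` -/
  | beta (t u : Term .num) : RCA₀ (eq (app (lam t) u) (t.subst (Sub.single u)))
  | prec_zero (a b : Term .num) : RCA₀ (eq (prec a b zero) a)
  | prec_succ (a b t : Term .num) :
      RCA₀ (eq (prec a b (succ t)) (b.subst (Sub.double (prec a b t) t)))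
  /-- Extensionality: `∀ x, f(x) = g(x)` implies `t(f) = t(g)`. -/
  | ext (t : Term .num) (f g : Term .fn) :
      RCA₀ (imp (all .num (eq (app (f.lift .num) (nv 0)) (app (g.lift .num) (nv 0))))
        (eq (t.subst (Sub.single f)) (t.subst (Sub.single g))))
  /-- Quantifier-free induction: `φ(0) → (∀ x, φ(x) → φ(x + 1)) → ∀ x, φ(x)`. -/
  | ind (φ : Formula) (hφ : φ.QuantifierFree) :
      RCA₀ (imp (φ.inst zero) (imp (all .num (imp φ (φ.subst Sub.next))) (all .num φ)))
  /-- Quantifier-free choice: `(∀ x, ∃ y, φ(x, y)) → ∃ f, ∀ x, φ(x, f(x))`. -/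
  | choice (φ : Formula) (hφ : φ.QuantifierFree) :
      RCA₀ (imp (all .num (ex .num φ)) (ex .fn (all .num (φ.subst Sub.choice))))

/-- `φ` is provable from the axioms `T`. -/
def Provable (T : Formula → Prop) (φ : Formula) : Prop := Deriv T [] φ

/-! ### Some primitive recursive terms -/

/-- The term `1`. -/
def one : Term .num := succ zero

/-- Predecessor. -/
def pred (t : Term .num) : Term .num := prec zero (nv 1) t

/-- Truncated subtraction `t ∸ u`. -/
def monus (t u : Term .num) : Term .num := prec t (pred (nv 0)) u

/-- `2 ^ t` -/
def twoPow (t : Term .num) : Term .num := prec one (add (nv 0) (nv 0)) t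

/-- The triangular number `0 + 1 + ⋯ + t`. -/
def tri (t : Term .num) : Term .num := prec zero (add (nv 0) (succ (nv 1))) t

/-- The largest `w` with `tri w ≤ t`. -/
def triRoot (t : Term .num) : Term .num :=
  prec zero (add (nv 0) (monus one (monus (tri (succ (nv 0))) (succ (nv 1))))) t

/-- The Cantor pairing `⟨t, u⟩`, a bijection between pairs of numbers and numbers. -/
def pair (t u : Term .num) : Term .num := add (tri (add t u)) u

/-- `right ⟨t, u⟩ = u` -/
def right (t : Term .num) : Term .num := monus t (tri (triRoot t))

/-- `left ⟨t, u⟩ = t` -/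
def left (t : Term .num) : Term .num := monus (triRoot t) (right t)

/-- `t ≤ u` -/
def le (t u : Term .num) : Formula := eq (monus t u) zero

/-! ### Rational numbers

The number `⟨⟨a, b⟩, c⟩` codes the rational number `(a - b) / (c + 1)`. Every number is a code. -/

/-- The code of `(a - b) / (c + 1)`. -/
def qMk (a b c : Term .num) : Term .num := pair (pair a b) c

/-- The number `a` of a code. -/
def qPos (q : Term .num) : Term .num := left (left q)

/-- The number `b` of a code. -/
def qNeg (q : Term .num) : Term .num := right (left q)

/-- The denominator `c + 1` of a code. -/
def qDen (q : Term .num) : Term .num := succ (right q)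

/-- The sum of two coded rationals. -/
def qAdd (p q : Term .num) : Term .num :=
  qMk (add (mul (qPos p) (qDen q)) (mul (qPos q) (qDen p)))
    (add (mul (qNeg p) (qDen q)) (mul (qNeg q) (qDen p)))
    (pred (mul (qDen p) (qDen q)))

/-- The negative of a coded rational. -/
def qOpp (q : Term .num) : Term .num := qMk (qNeg q) (qPos q) (right q)

/-- The product of two coded rationals. -/
def qMul (p q : Term .num) : Term .num :=
  qMk (add (mul (qPos p) (qPos q)) (mul (qNeg p) (qNeg q)))
    (add (mul (qPos p) (qNeg q)) (mul (qNeg p) (qPos q)))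
    (pred (mul (qDen p) (qDen q)))

/-- `p ≤ q` for coded rationals. -/
def qLe (p q : Term .num) : Formula :=
  le (add (mul (qPos p) (qDen q)) (mul (qNeg q) (qDen p)))
    (add (mul (qPos q) (qDen p)) (mul (qNeg p) (qDen q)))

/-- The code of `t / 2 ^ k`. -/
def qDyadic (t k : Term .num) : Term .num := qMk t zero (pred (twoPow k))

/-- `|p - q| ≤ r` for coded rationals. -/
def qDistLe (p q r : Term .num) : Formula := and (qLe p (qAdd q r)) (qLe q (qAdd p r))

/-! ### Real numbers: quickly converging Cauchy sequences of rationals -/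

/-- `f` is a real number: a sequence of rationals with `|f(k) - f(k + i)| ≤ 2⁻ᵏ` for all `k, i`. -/
def isReal (f : Term .fn) : Formula :=
  let f' := (f.lift .num).lift .num
  all .num (all .num
    (qDistLe (app f' (nv 1)) (app f' (add (nv 1) (nv 0))) (qDyadic one (nv 1))))

/-- Equality of real numbers: `|f(k) - g(k)| ≤ 2 · 2⁻ᵏ` for all `k`. -/
def rEq (f g : Term .fn) : Formula :=
  all .num (qDistLe (app (f.lift .num) (nv 0)) (app (g.lift .num) (nv 0))
    (qDyadic (succ one) (nv 0)))

/-- The real number `0`. -/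
def rZero : Term .fn := lam (qMk zero zero zero)

/-- The real number `1`. -/
def rOne : Term .fn := lam (qMk one zero zero)

/-- Sum of real numbers: `k ↦ f(k + 1) + g(k + 1)`. -/
def rAdd (f g : Term .fn) : Term .fn :=
  lam (qAdd (app (f.lift .num) (succ (nv 0))) (app (g.lift .num) (succ (nv 0))))

/-- Negative of a real number. -/
def rOpp (f : Term .fn) : Term .fn := lam (qOpp (app (f.lift .num) (nv 0)))

/-- A natural number that is at least the absolute value of the coded rational `q`. -/
def qBound (q : Term .num) : Term .num := add (qPos q) (qNeg q)

/-- Product of real numbers: `k ↦ f(m + k) · g(m + k)` with an `m` such that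
`|f(0)| + |g(0)| + 2 ≤ 2ᵐ`. -/
def rMul (f g : Term .fn) : Term .fn :=
  let f' := f.lift .num
  let g' := g.lift .num
  let m := add (add (qBound (app f' zero)) (qBound (app g' zero))) (succ one)
  lam (qMul (app f' (add m (nv 0))) (app g' (add m (nv 0))))

/-! ### Complex numbers and `2 × 2` matrices -/

/-- A (term for a) complex number: its real part and its imaginary part. -/
structure CTerm where
  re : Term .fn
  im : Term .fn

def isComplex (z : CTerm) : Formula := and (isReal z.re) (isReal z.im)

def cEq (z w : CTerm) : Formula := and (rEq z.re w.re) (rEq z.im w.im)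

def cZero : CTerm := ⟨rZero, rZero⟩

def cOne : CTerm := ⟨rOne, rZero⟩

def cAdd (z w : CTerm) : CTerm := ⟨rAdd z.re w.re, rAdd z.im w.im⟩

def cMul (z w : CTerm) : CTerm :=
  ⟨rAdd (rMul z.re w.re) (rOpp (rMul z.im w.im)), rAdd (rMul z.re w.im) (rMul z.im w.re)⟩

/-- A (term for a) `2 × 2` matrix `(a b; c d)` of complex numbers. -/
structure MTerm where
  a : CTerm
  b : CTerm
  c : CTerm
  d : CTerm

def isMatrix (A : MTerm) : Formula :=
  and (and (isComplex A.a) (isComplex A.b)) (and (isComplex A.c) (isComplex A.d))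

def mEq (A B : MTerm) : Formula :=
  and (and (cEq A.a B.a) (cEq A.b B.b)) (and (cEq A.c B.c) (cEq A.d B.d))

def mOne : MTerm := ⟨cOne, cZero, cZero, cOne⟩

def mMul (A B : MTerm) : MTerm :=
  ⟨cAdd (cMul A.a B.a) (cMul A.b B.c), cAdd (cMul A.a B.b) (cMul A.b B.d),
   cAdd (cMul A.c B.a) (cMul A.d B.c), cAdd (cMul A.c B.b) (cMul A.d B.d)⟩

/-- `V` is the inverse of `U`. -/
def isInverse (U V : MTerm) : Formula := and (mEq (mMul U V) mOne) (mEq (mMul V U) mOne)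

/-- `J` consists of Jordan blocks: it is `(x 0; 0 y)`, that is, two blocks of size one, or it is
`(x 1; 0 x)`, that is, one block of size two. -/
def isJordan (J : MTerm) : Formula :=
  and (cEq J.c cZero) (or (cEq J.b cZero) (and (cEq J.b cOne) (cEq J.a J.d)))

/-- The matrix whose entries are given by the function variables `k, …, k + 7`. -/
def mVar (k : ℕ) : MTerm :=
  ⟨⟨fv k, fv (k + 1)⟩, ⟨fv (k + 2), fv (k + 3)⟩, ⟨fv (k + 4), fv (k + 5)⟩,
   ⟨fv (k + 6), fv (k + 7)⟩⟩

/-- Universal quantification over function variables `0, …, n - 1`. -/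
def allFn (n : ℕ) (φ : Formula) : Formula := (all .fn)^[n] φ

/-- Existential quantification over function variables `0, …, n - 1`. -/
def exFn (n : ℕ) (φ : Formula) : Formula := (ex .fn)^[n] φ

/-- The formula saying that the matrix `M` given by function variables `0, …, 7` has a Jordan
decomposition: there are `U`, `J` and `V = U⁻¹`, with `J` consisting of Jordan blocks, such that
`M = U J V`. Under the 24 quantifiers for the entries of `U`, `J`, `V`, the variables of `M` have the
indices `24, …, 31`. -/
def hasJordanDecomposition : Formula :=
  let U := mVar 0
  let J := mVar 8
  let V := mVar 16
  let M := mVar 24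
  exFn 24 (and (and (isMatrix U) (and (isMatrix J) (isMatrix V)))
    (and (isInverse U V) (and (isJordan J) (mEq M (mMul (mMul U J) V)))))

/-- The sentence saying that every `2 × 2` matrix of complex numbers has a Jordan decomposition. -/
def jordanSentence : Formula := allFn 8 (imp (isMatrix (mVar 0)) hasJordanDecomposition)

end RCA

namespace RCA

open Term Formula

/-! ### Substitution -/

/-! No derivation is written out. By the completeness theorem `Provable.of_henkin`, it suffices that
the sentence holds in every Henkin theory over `RCA₀`, that is, in every (possibly nonstandard)
two-sorted model made of terms. Since the logic is classical, ordinary mathematics can be done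
inside such a model. The weakness of the system shows only in induction and choice, which are
available for quantifier-free predicates alone; `Henkin.Def` and `Henkin.QF` keep track of what is
definable in this way.

The numbers of the model form a cancellative semiring, totally ordered by addition, which embeds
into an ordered field of fractions of differences. Codes of rationals denote exactly the elements of
this field. Function terms denote sequences in it, indexed by the numbers of the model. Quickly
converging sequences modulo null sequences form a ring `SeqSpace.R`, and the formula `rEq` expresses
equality in it (`SeqSpace.lim_eq_lim_iff`). A nonzero element has a representative of constant sign
that is bounded away from `0` (`SeqSpace.exists_bounded`). Therefore termwise inversion makes
`SeqSpace.R` a field, and choosing rational approximations to termwise square roots shows that every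
element or its negative is a square (`SeqSpace.exists_sqrt`). Moreover, a sum of three squares
vanishes only trivially.

These algebraic facts suffice: adjoining `i` gives a field in which everything has a square root
(`Cplx.exists_sqrt`), so the quadratic formula yields the eigenvalues of a `2 × 2` matrix, and its
Jordan form is found by cases (`exists_jordan`). Whether the eigenvalues coincide is not decidable,
but the distinction is made once, for a single matrix, which classical logic permits. Finally, the
terms for real and complex arithmetic denote the operations of these fields (`Henkin.Rep`,
`Henkin.CRep`, `Henkin.MRep`), which carries the decomposition back into the language. -/

theorem Ren.up_comp (ρ ρ' : Ren) (r : Srt) :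
    (fun s i => ρ'.up r s (ρ.up r s i)) = Ren.up (fun s i => ρ' s (ρ s i)) r := by
  funext s i
  cases r <;> cases s <;> cases i <;> rfl

theorem Sub.up_comp_ren (σ : Sub) (ρ : Ren) (r : Srt) :
    (fun s i => σ.up r s (ρ.up r s i)) = Sub.up (fun s i => σ s (ρ s i)) r := by
  funext s i
  cases r <;> cases s <;> cases i <;> rfl

theorem Term.rename_subst {s : Srt} (t : Term s) (ρ : Ren) (σ : Sub) :
    (t.rename ρ).subst σ = t.subst (fun s i => σ s (ρ s i)) := by
  induction t generalizing ρ σ <;> simp_all [Term.rename, Term.subst, Sub.up_comp_ren]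

theorem Term.rename_rename {s : Srt} (t : Term s) (ρ ρ' : Ren) :
    (t.rename ρ).rename ρ' = t.rename (fun s i => ρ' s (ρ s i)) := by
  induction t generalizing ρ ρ' <;> simp_all [Term.rename, Ren.up_comp]

theorem Term.lift_rename {s : Srt} (t : Term s) (ρ : Ren) (r : Srt) :
    (t.lift r).rename (ρ.up r) = (t.rename ρ).lift r := by
  simp only [Term.lift, Term.rename_rename]
  congr 1
  funext s i
  cases r <;> cases s <;> rfl

theorem Sub.up_rename (σ : Sub) (ρ : Ren) (r : Srt) :
    (fun s i => (σ.up r s i).rename (ρ.up r)) = Sub.up (fun s i => (σ s i).rename ρ) r := by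
  funext s i
  cases r <;> cases s <;> cases i <;> first | rfl | exact Term.lift_rename _ _ _

theorem Term.subst_rename {s : Srt} (t : Term s) (σ : Sub) (ρ : Ren) :
    (t.subst σ).rename ρ = t.subst (fun s i => (σ s i).rename ρ) := by
  induction t generalizing σ ρ <;> simp_all [Term.rename, Term.subst, Sub.up_rename]

theorem Sub.up_shift (σ : Sub) (r s : Srt) (i : ℕ) :
    σ.up r s (Ren.shift r s i) = (σ s i).lift r := by
  cases r <;> cases s <;> rfl

@[simp] theorem Term.lift_subst_up {s : Srt} (t : Term s) (σ : Sub) (r : Srt) :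
    (t.lift r).subst (σ.up r) = (t.subst σ).lift r := by
  simp only [Term.lift, Term.rename_subst, Term.subst_rename, Sub.up_shift]

theorem Sub.up_comp (σ τ : Sub) (r : Srt) :
    (fun s i => (σ.up r s i).subst (τ.up r)) = Sub.up (fun s i => (σ s i).subst τ) r := by
  funext s i
  cases r <;> cases s <;> cases i <;> first | rfl | exact Term.lift_subst_up _ _ _

/-- Under a binder the values of a substitution are lifted, and lifting is a renaming; this is why
the mixed laws for renamings and substitutions have to precede this one. -/
theorem Term.subst_subst {s : Srt} (t : Term s) (σ τ : Sub) :
    (t.subst σ).subst τ = t.subst (fun s i => (σ s i).subst τ) := by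
  induction t generalizing σ τ <;> simp_all [Term.subst, Sub.up_comp]

theorem Formula.subst_subst (φ : Formula) (σ τ : Sub) :
    (φ.subst σ).subst τ = φ.subst (fun s i => (σ s i).subst τ) := by
  induction φ generalizing σ τ <;>
    simp_all [Formula.subst, Term.subst_subst, Sub.up_comp]

/-- The identity substitution. -/
def Sub.id : Sub := fun s i => .var s i

theorem Sub.up_id (r : Srt) : Sub.id.up r = Sub.id := by
  funext s i
  cases r <;> cases s <;> cases i <;> rfl

@[simp] theorem Term.subst_id {s : Srt} (t : Term s) : t.subst Sub.id = t := by
  induction t <;> simp_all [Term.subst, Sub.up_id]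
  rfl

@[simp] theorem Formula.subst_id (φ : Formula) : φ.subst Sub.id = φ := by
  induction φ <;> simp_all [Formula.subst, Sub.up_id]

theorem Sub.single_shift {r : Srt} (u : Term r) (s : Srt) (i : ℕ) :
    Sub.single u s (Ren.shift r s i) = .var s i := by
  cases r <;> cases s <;> rfl

@[simp] theorem Term.lift_subst_single {s r : Srt} (t : Term s) (u : Term r) :
    (t.lift r).subst (Sub.single u) = t := by
  simp only [Term.lift, Term.rename_subst, Sub.single_shift]
  exact t.subst_id

/-- Assign `u` to variable `0` of sort `r` and the values of `σ` to the other variables. -/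
def Sub.cons (σ : Sub) : {r : Srt} → Term r → Sub
  | .num, u, .num, 0 => u
  | .num, _, .num, i + 1 => σ .num i
  | .num, _, .fn, i => σ .fn i
  | .fn, _, .num, i => σ .num i
  | .fn, u, .fn, 0 => u
  | .fn, _, .fn, i + 1 => σ .fn i

theorem Sub.up_comp_single (σ : Sub) {r : Srt} (u : Term r) :
    (fun s i => (σ.up r s i).subst (Sub.single u)) = σ.cons u := by
  funext s i
  cases r <;> cases s <;> cases i <;> first | rfl | exact Term.lift_subst_single _ _

/-- Peels off one quantifier: an instance of a substituted body is again one simultaneous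
substitution, so nested quantifiers are evaluated by accumulating `Sub.cons`. -/
theorem Formula.subst_up_inst (φ : Formula) (σ : Sub) {r : Srt} (u : Term r) :
    (φ.subst (σ.up r)).inst u = φ.subst (σ.cons u) := by
  rw [Formula.inst, Formula.subst_subst, Sub.up_comp_single]

theorem Term.subst_up_single {s : Srt} (t : Term s) (σ : Sub) {r : Srt} (u : Term r) :
    (t.subst (σ.up r)).subst (Sub.single u) = t.subst (σ.cons u) := by
  rw [Term.subst_subst, Sub.up_comp_single]

theorem Sub.single_comp (σ : Sub) {r : Srt} (u : Term r) :
    (fun s i => (Sub.single u s i).subst σ) = σ.cons (u.subst σ) := by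
  funext s i
  cases r <;> cases s <;> cases i <;> rfl

theorem Term.subst_single_subst {s r : Srt} (t : Term s) (u : Term r) (σ : Sub) :
    (t.subst (Sub.single u)).subst σ = (t.subst (σ.up r)).subst (Sub.single (u.subst σ)) := by
  rw [Term.subst_up_single, Term.subst_subst, Sub.single_comp]

theorem Formula.inst_subst (φ : Formula) {r : Srt} (u : Term r) (σ : Sub) :
    (φ.inst u).subst σ = (φ.subst (σ.up r)).inst (u.subst σ) := by
  rw [Formula.subst_up_inst, Formula.inst, Formula.subst_subst, Sub.single_comp]

theorem Formula.lift_subst_up (φ : Formula) (σ : Sub) (r : Srt) :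
    (φ.lift r).subst (σ.up r) = (φ.subst σ).lift r := by
  simp only [Formula.lift, Formula.subst_subst]
  congr 1
  funext s i
  have := Sub.up_shift σ r s i
  simp only [Term.subst, this, Term.lift]
  -- `Formula.lift` substitutes variables while `Term.lift` renames them; the identity substitution
  -- turns the renaming into a substitution.
  rw [← Term.subst_id ((σ s i).rename _), Term.rename_subst]
  rfl

theorem Formula.QuantifierFree.subst {φ : Formula} (h : φ.QuantifierFree) (σ : Sub) :
    (φ.subst σ).QuantifierFree := by
  induction φ with
  | eq => trivial
  | falsum => trivial
  | imp φ ψ h₁ h₂ => exact ⟨h₁ h.1, h₂ h.2⟩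
  | all => exact h.elim

theorem Term.double_subst {s : Srt} (b : Term s) (t u : Term .num) (σ : Sub) :
    (b.subst (Sub.double t u)).subst σ =
      (b.subst ((σ.up .num).up .num)).subst (Sub.double (t.subst σ) (u.subst σ)) := by
  rw [Term.subst_subst, Term.subst_subst]
  congr 1
  funext s i
  have key : ∀ {s} (x : Term s), ((x.lift .num).lift .num).subst
      (Sub.double (t.subst σ) (u.subst σ)) = x := by
    intro s x
    simp only [Term.lift, Term.rename_subst]
    conv_rhs => rw [← x.subst_id]
    congr 1
    funext s i
    cases s <;> rfl
  match s, i with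
  | .num, 0 => rfl
  | .num, 1 => rfl
  | .num, i + 2 => exact (key _).symm
  | .fn, i => exact (key _).symm

theorem Formula.next_subst (φ : Formula) (σ : Sub) :
    (φ.subst Sub.next).subst (σ.up .num) = (φ.subst (σ.up .num)).subst Sub.next := by
  rw [Formula.subst_subst, Formula.subst_subst]
  congr 1
  funext s i
  have key : ∀ {s} (x : Term s), (x.lift .num).subst Sub.next = x.lift .num := by
    intro s x
    simp only [Term.lift, Term.rename_subst]
    conv_rhs => rw [← (x.rename _).subst_id, Term.rename_subst]
    congr 1
    funext s i
    cases s <;> rfl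
  match s, i with
  | .num, 0 => rfl
  | .num, i + 1 => exact (key _).symm
  | .fn, i => exact (key _).symm

theorem Formula.choice_subst (φ : Formula) (σ : Sub) :
    (φ.subst Sub.choice).subst ((σ.up .fn).up .num) =
      (φ.subst ((σ.up .num).up .num)).subst Sub.choice := by
  rw [Formula.subst_subst, Formula.subst_subst]
  congr 1
  funext s i
  have key : ∀ {s} (x : Term s),
      ((x.lift .num).lift .num).subst Sub.choice = (x.lift .fn).lift .num := by
    intro s x
    simp only [Term.lift, Term.rename_subst, Term.rename_rename]
    conv_rhs => rw [← (x.rename _).subst_id, Term.rename_subst]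
    congr 1
    funext s i
    cases s <;> rfl
  match s, i with
  | .num, 0 => rfl
  | .num, 1 => rfl
  | .num, i + 2 => exact (key _).symm
  | .fn, i => exact (key _).symm

/-- The axioms are schemes in arbitrary terms and formulas, so substituting in an axiom gives the
same axiom for the substituted data. This makes free variables in axioms behave as universally
closed. -/
theorem RCA₀.subst {φ : Formula} (h : RCA₀ φ) (σ : Sub) : RCA₀ (φ.subst σ) := by
  cases h with
  | succ_ne_zero t => exact .succ_ne_zero _
  | succ_inj t u => exact .succ_inj _ _
  | add_zero t => exact .add_zero _
  | add_succ t u => exact .add_succ _ _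
  | mul_zero t => exact .mul_zero _
  | mul_succ t u => exact .mul_succ _ _
  | beta t u =>
    simp only [Formula.subst, Term.subst, Term.subst_single_subst]
    exact .beta _ _
  | prec_zero a b => exact .prec_zero _ _
  | prec_succ a b t =>
    simp only [Formula.subst, Term.subst, Term.double_subst]
    exact .prec_succ _ _ _
  | ext t f g =>
    have := RCA₀.ext (t.subst (σ.up .fn)) (f.subst σ) (g.subst σ)
    simpa only [Formula.subst, Term.subst, Term.subst_single_subst, Term.lift_subst_up, Sub.up]
      using this
  | ind φ hφ =>
    have := RCA₀.ind (φ.subst (σ.up .num)) (hφ.subst _)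
    simpa only [Formula.subst, Term.subst, Formula.inst_subst, Formula.next_subst] using this
  | choice φ hφ =>
    have := RCA₀.choice (φ.subst ((σ.up .num).up .num)) (hφ.subst _)
    simpa only [Formula.subst, Formula.ex, Formula.neg, Formula.choice_subst] using this

/-! ### Derivations -/

theorem Deriv.weaken {T : Formula → Prop} {Γ Δ : List Formula} {φ : Formula} (h : Deriv T Γ φ)
    (hΓ : Γ ⊆ Δ) : Deriv T Δ φ := by
  induction h generalizing Δ with
  | ax h => exact .ax h
  | hyp h => exact .hyp (hΓ h)
  | impI _ ih => exact .impI (ih (List.cons_subset_cons _ hΓ))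
  | impE _ _ ih₁ ih₂ => exact .impE (ih₁ hΓ) (ih₂ hΓ)
  | raa _ ih => exact .raa (ih (List.cons_subset_cons _ hΓ))
  | allI _ ih => exact .allI (ih (List.map_subset _ hΓ))
  | allE t _ ih => exact .allE t (ih hΓ)
  | eqRefl t => exact .eqRefl t
  | eqSubst φ _ _ ih₁ ih₂ => exact .eqSubst φ (ih₁ hΓ) (ih₂ hΓ)

/-- Allows a fresh free variable of a derivation to be turned into the variable that `allI` binds.
-/
theorem Deriv.subst {T : Formula → Prop} (hT : ∀ φ, T φ → ∀ σ, T (φ.subst σ)) {Γ : List Formula}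
    {φ : Formula} (h : Deriv T Γ φ) (σ : Sub) :
    Deriv T (Γ.map fun ψ => ψ.subst σ) (φ.subst σ) := by
  induction h generalizing σ with
  | ax h => exact .ax (hT _ h σ)
  | hyp h => exact .hyp (List.mem_map_of_mem h)
  | impI _ ih => exact .impI (ih σ)
  | impE _ _ ih₁ ih₂ => exact .impE (ih₁ σ) (ih₂ σ)
  | raa _ ih => exact .raa (ih σ)
  | @allI Γ s φ _ ih =>
    refine .allI ?_
    have := ih (σ.up s)
    simpa only [List.map_map, Function.comp_def, Formula.lift_subst_up] using this
  | allE t _ ih =>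
    rw [Formula.inst_subst]
    exact .allE _ (ih σ)
  | eqRefl t => exact .eqRefl _
  | eqSubst φ _ _ ih₁ ih₂ =>
    have h₁ := ih₁ σ
    have h₂ := ih₂ σ
    rw [Formula.inst_subst] at h₂ ⊢
    exact .eqSubst _ h₁ h₂

theorem Deriv.cut {T : Formula → Prop} {Γ : List Formula} {φ ψ : Formula} (h : Deriv T Γ φ)
    (h' : Deriv T (φ :: Γ) ψ) : Deriv T Γ ψ :=
  .impE (.impI h') h

/-! ### Fresh variables -/

/-- Every term depends on finitely many variables only. -/
theorem Term.exists_bound {s : Srt} (t : Term s) :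
    ∃ n, ∀ σ τ : Sub, (∀ s i, i < n → σ s i = τ s i) → t.subst σ = t.subst τ := by
  have up : ∀ (n : ℕ) (σ τ : Sub) (r : Srt), (∀ s i, i < n → σ s i = τ s i) →
      ∀ s i, i < n → σ.up r s i = τ.up r s i := by
    intro n σ τ r h s i hi
    cases r <;> cases s <;> cases i <;>
      simp only [Sub.up] <;> congr 1 <;> exact h _ _ (by omega)
  induction t with
  | var s i => exact ⟨i + 1, fun σ τ h => h s i (Nat.lt_succ_self i)⟩
  | zero => exact ⟨0, fun _ _ _ => rfl⟩
  | succ t ih =>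
    obtain ⟨n, hn⟩ := ih
    exact ⟨n, fun σ τ h => by rw [Term.subst, Term.subst, hn σ τ h]⟩
  | lam t ih =>
    obtain ⟨n, hn⟩ := ih
    exact ⟨n, fun σ τ h => by rw [Term.subst, Term.subst, hn _ _ (up n σ τ _ h)]⟩
  | add t u ih₁ ih₂ | mul t u ih₁ ih₂ | app t u ih₁ ih₂ =>
    obtain ⟨n, hn⟩ := ih₁
    obtain ⟨m, hm⟩ := ih₂
    refine ⟨n + m, fun σ τ h => ?_⟩
    rw [Term.subst, Term.subst, hn σ τ fun s i hi => h s i (by omega),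
      hm σ τ fun s i hi => h s i (by omega)]
  | prec a b t ih₁ ih₂ ih₃ =>
    obtain ⟨n, hn⟩ := ih₁
    obtain ⟨m, hm⟩ := ih₂
    obtain ⟨k, hk⟩ := ih₃
    refine ⟨n + m + k, fun σ τ h => ?_⟩
    rw [Term.subst, Term.subst, hn σ τ fun s i hi => h s i (by omega),
      hm _ _ (up m _ _ _ (up m σ τ _ fun s i hi => h s i (by omega))),
      hk σ τ fun s i hi => h s i (by omega)]

theorem Formula.exists_bound (φ : Formula) :
    ∃ n, ∀ σ τ : Sub, (∀ s i, i < n → σ s i = τ s i) → φ.subst σ = φ.subst τ := by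
  induction φ with
  | eq t u =>
    obtain ⟨n, hn⟩ := t.exists_bound
    obtain ⟨m, hm⟩ := u.exists_bound
    refine ⟨n + m, fun σ τ h => ?_⟩
    rw [Formula.subst, Formula.subst, hn σ τ fun s i hi => h s i (by omega),
      hm σ τ fun s i hi => h s i (by omega)]
  | falsum => exact ⟨0, fun _ _ _ => rfl⟩
  | imp φ ψ ih₁ ih₂ =>
    obtain ⟨n, hn⟩ := ih₁
    obtain ⟨m, hm⟩ := ih₂
    refine ⟨n + m, fun σ τ h => ?_⟩
    rw [Formula.subst, Formula.subst, hn σ τ fun s i hi => h s i (by omega),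
      hm σ τ fun s i hi => h s i (by omega)]
  | all r φ ih =>
    obtain ⟨n, hn⟩ := ih
    refine ⟨n, fun σ τ h => ?_⟩
    rw [Formula.subst, Formula.subst, hn]
    intro s i hi
    cases r <;> cases s <;> cases i <;>
      simp only [Sub.up] <;> congr 1 <;> exact h _ _ (by omega)

/-- Generalization on a variable that does not occur in the hypotheses. -/
theorem Deriv.exists_fresh {T : Formula → Prop} (hT : ∀ φ, T φ → ∀ σ, T (φ.subst σ))
    (Γ : List Formula) (s : Srt) (ψ : Formula) :
    ∃ t : Term s, Deriv T Γ (ψ.inst t) → Deriv T Γ (all s ψ) := by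
  have hb : ∃ n, ∀ χ ∈ ψ :: Γ, ∀ σ τ : Sub, (∀ s i, i < n → σ s i = τ s i) →
      χ.subst σ = χ.subst τ := by
    generalize ψ :: Γ = Δ
    induction Δ with
    | nil => exact ⟨0, by simp⟩
    | cons χ Δ ih =>
      obtain ⟨n, hn⟩ := ih
      obtain ⟨m, hm⟩ := χ.exists_bound
      refine ⟨n + m, fun ξ hξ σ τ h => ?_⟩
      rcases List.mem_cons.1 hξ with rfl | hξ
      · exact hm σ τ fun s i hi => h s i (by omega)
      · exact hn ξ hξ σ τ fun s i hi => h s i (by omega)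
  obtain ⟨n, hn⟩ := hb
  refine ⟨.var s n, fun h => .allI ?_⟩
  -- Variable `n` becomes the variable `0` to be bound and the others of sort `s` move up. All
  -- variables that matter in `ψ` and `Γ` lie below `n`, so `σ` acts on `Γ` as a lift and undoes the
  -- instantiation of `ψ`.
  let σ : Sub := fun r i =>
    match r, s with
    | .num, .num => if i = n then .nv 0 else .nv (i + 1)
    | .num, .fn => .nv i
    | .fn, .num => .fv i
    | .fn, .fn => if i = n then .fv 0 else .fv (i + 1)
  have h' := h.subst hT σ
  have e₁ : (ψ.inst (.var s n)).subst σ = ψ := by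
    rw [Formula.inst, Formula.subst_subst]
    conv_rhs => rw [← ψ.subst_id]
    refine hn ψ (by simp) _ _ fun r i hi => ?_
    cases s <;> cases r <;> cases i <;>
      simp [Sub.single, Term.subst, σ, Sub.id, Term.nv, Term.fv] <;> omega
  have e₂ : (Γ.map fun χ => χ.subst σ) = Γ.map fun χ => χ.lift s := by
    refine List.map_congr_left fun χ hχ => ?_
    refine hn χ (by simp [hχ]) _ _ fun r i hi => ?_
    have : i ≠ n := by omega
    cases s <;> cases r <;> simp [σ, this, Ren.shift]
  rwa [e₁, e₂] at h'

/-! ### Countability of the language -/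

/-- An injective numbering of the terms. -/
def Term.code : {s : Srt} → Term s → ℕ
  | _, .var .num i => Nat.pair 0 i
  | _, .var .fn i => Nat.pair 1 i
  | _, .zero => Nat.pair 2 0
  | _, .succ t => Nat.pair 3 t.code
  | _, .add t u => Nat.pair 4 (Nat.pair t.code u.code)
  | _, .mul t u => Nat.pair 5 (Nat.pair t.code u.code)
  | _, .app t u => Nat.pair 6 (Nat.pair t.code u.code)
  | _, .lam t => Nat.pair 7 t.code
  | _, .prec a b t => Nat.pair 8 (Nat.pair a.code (Nat.pair b.code t.code))

theorem Term.code_injective {s : Srt} (t u : Term s) (h : t.code = u.code) : t = u := by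
  induction t with
  | var s i =>
    cases s <;> cases u <;> simp_all [Term.code, Nat.pair_eq_pair]
  | zero => cases u <;> simp [Term.code, Nat.pair_eq_pair] at h ⊢
  | succ t ih => cases u with
    | succ t' =>
      simp only [Term.code, Nat.pair_eq_pair] at h
      rw [ih _ h.2]
    | _ => simp [Term.code, Nat.pair_eq_pair] at h
  | lam t ih => cases u with
    | lam t' =>
      simp only [Term.code, Nat.pair_eq_pair] at h
      rw [ih _ h.2]
    | _ => simp [Term.code, Nat.pair_eq_pair] at h
  | add t u ih₁ ih₂ => cases u with
    | add t' u' =>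
      simp only [Term.code, Nat.pair_eq_pair] at h
      rw [ih₁ _ h.2.1, ih₂ _ h.2.2]
    | _ => simp [Term.code, Nat.pair_eq_pair] at h
  | mul t u ih₁ ih₂ => cases u with
    | mul t' u' =>
      simp only [Term.code, Nat.pair_eq_pair] at h
      rw [ih₁ _ h.2.1, ih₂ _ h.2.2]
    | _ => simp [Term.code, Nat.pair_eq_pair] at h
  | app t u ih₁ ih₂ => cases u with
    | app t' u' =>
      simp only [Term.code, Nat.pair_eq_pair] at h
      rw [ih₁ _ h.2.1, ih₂ _ h.2.2]
    | _ => simp [Term.code, Nat.pair_eq_pair] at h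
  | prec a b t ih₁ ih₂ ih₃ => cases u with
    | prec a' b' t' =>
      simp only [Term.code, Nat.pair_eq_pair] at h
      rw [ih₁ _ h.2.1, ih₂ _ h.2.2.1, ih₃ _ h.2.2.2]
    | _ => simp [Term.code, Nat.pair_eq_pair] at h

/-- An injective numbering of the formulas. -/
def Formula.code : Formula → ℕ
  | .eq t u => Nat.pair 0 (Nat.pair t.code u.code)
  | .falsum => Nat.pair 1 0
  | .imp φ ψ => Nat.pair 2 (Nat.pair φ.code ψ.code)
  | .all .num φ => Nat.pair 3 φ.code
  | .all .fn φ => Nat.pair 4 φ.code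

theorem Formula.code_injective : Function.Injective Formula.code := by
  intro φ
  induction φ with
  | eq t u =>
    intro ψ h
    match ψ with
    | .eq t' u' =>
      simp only [Formula.code, Nat.pair_eq_pair] at h
      rw [t.code_injective _ h.2.1, u.code_injective _ h.2.2]
    | .falsum | .imp _ _ | .all .num _ | .all .fn _ => simp [Formula.code, Nat.pair_eq_pair] at h
  | falsum =>
    intro ψ h
    match ψ with
    | .falsum => rfl
    | .eq _ _ | .imp _ _ | .all .num _ | .all .fn _ => simp [Formula.code, Nat.pair_eq_pair] at h
  | imp φ χ ih₁ ih₂ =>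
    intro ψ h
    match ψ with
    | .imp φ' χ' =>
      simp only [Formula.code, Nat.pair_eq_pair] at h
      rw [ih₁ h.2.1, ih₂ h.2.2]
    | .eq _ _ | .falsum | .all .num _ | .all .fn _ => simp [Formula.code, Nat.pair_eq_pair] at h
  | all s φ ih =>
    intro ψ h
    match s, ψ with
    | .num, .all .num φ' | .fn, .all .fn φ' =>
      simp only [Formula.code, Nat.pair_eq_pair] at h
      rw [ih h.2]
    | .num, .all .fn φ' | .fn, .all .num φ' => simp [Formula.code, Nat.pair_eq_pair] at h
    | .num, .eq _ _ | .num, .falsum | .num, .imp _ _ => simp [Formula.code, Nat.pair_eq_pair] at h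
    | .fn, .eq _ _ | .fn, .falsum | .fn, .imp _ _ => simp [Formula.code, Nat.pair_eq_pair] at h

instance : Countable Formula := Formula.code_injective.countable

instance : Nonempty Formula := ⟨.falsum⟩

/-! ### Henkin theories -/

/-- A set of formulas that behaves like the set of all formulas that are true in a model of the
axioms `A`, all of whose objects are denoted by terms. -/
structure Henkin (A T : Formula → Prop) : Prop where
  falsum : ¬ T .falsum
  imp {φ ψ : Formula} : T (.imp φ ψ) ↔ (T φ → T ψ)
  all {s : Srt} {φ : Formula} : T (.all s φ) ↔ ∀ t : Term s, T (φ.inst t)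
  ax {φ : Formula} : A φ → T φ
  refl (t : Term .num) : T (.eq t t)
  eqSubst (φ : Formula) {t u : Term .num} : T (.eq t u) → T (φ.inst t) → T (φ.inst u)

/-- One step of the construction of a Henkin theory: deciding the formula `φ`. -/
theorem Deriv.exists_extension {A : Formula → Prop} (hA : ∀ φ, A φ → ∀ σ, A (φ.subst σ))
    {Γ : List Formula} (hΓ : ¬ Deriv A Γ .falsum) (φ : Formula) :
    ∃ Δ : List Formula, Γ ⊆ Δ ∧ ¬ Deriv A Δ .falsum ∧ (φ ∈ Δ ∨ φ.neg ∈ Δ ∧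
      ∀ s ψ, φ = .all s ψ → ∃ t : Term s, (ψ.inst t).neg ∈ Δ) := by
  by_cases h : Deriv A (φ :: Γ) .falsum
  · have h₁ : Deriv A Γ φ.neg := .impI h
    by_cases hφ : ∃ s ψ, φ = .all s ψ
    · obtain ⟨s, ψ, rfl⟩ := hφ
      obtain ⟨t, ht⟩ := Deriv.exists_fresh hA Γ s ψ
      refine ⟨(Formula.all s ψ).neg :: (ψ.inst t).neg :: Γ, fun x hx => by simp [hx], fun h₂ => ?_,
        .inr ⟨by simp, fun s' ψ' e => ?_⟩⟩
      -- If adding the counterexample were inconsistent, the instance at the fresh `t` would be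
      -- derivable, hence also the universal formula, which `Γ` refutes.
      · have h₃ : Deriv A ((ψ.inst t).neg :: Γ) .falsum :=
          Deriv.cut (h₁.weaken fun x hx => by simp [hx]) h₂
        exact hΓ (.impE h₁ (ht (.raa h₃)))
      · cases e
        exact ⟨t, by simp⟩
    · refine ⟨φ.neg :: Γ, fun x hx => by simp [hx], fun h₂ => hΓ (h₁.cut h₂),
        .inr ⟨by simp, fun s ψ e => (hφ ⟨s, ψ, e⟩).elim⟩⟩
  · exact ⟨φ :: Γ, fun x hx => by simp [hx], h, .inl (by simp)⟩

/-- Completeness: what holds in all Henkin theories is provable. -/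
theorem Provable.of_henkin {A : Formula → Prop} (hA : ∀ φ, A φ → ∀ σ, A (φ.subst σ)) {χ : Formula}
    (H : ∀ T, Henkin A T → T χ) : Provable A χ := by
  by_contra hχ
  have h₀ : ¬ Deriv A [χ.neg] .falsum := fun h => hχ (.raa h)
  obtain ⟨e, he⟩ := exists_surjective_nat Formula
  choose ext ext_sub ext_cons ext_dec using
    fun (Γ : {Γ : List Formula // ¬ Deriv A Γ .falsum}) (φ : Formula) =>
      Deriv.exists_extension hA Γ.2 φ
  -- Lindenbaum's construction with Henkin witnesses: stage `n + 1` decides the formula `e n`, and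
  -- all stages are finite and consistent. The theory is their union.
  let G : ℕ → {Γ : List Formula // ¬ Deriv A Γ .falsum} := fun n =>
    n.rec ⟨[χ.neg], h₀⟩ fun n Γ => ⟨ext Γ (e n), ext_cons Γ (e n)⟩
  have mono : ∀ m n, m ≤ n → (G m).1 ⊆ (G n).1 := by
    intro m n h
    induction n, h using Nat.le_induction with
    | base => exact fun _ h => h
    | succ n _ ih => exact fun x hx => ext_sub (G n) (e n) (ih hx)
  have dec : ∀ φ : Formula, ∃ n, φ ∈ (G n).1 ∨ φ.neg ∈ (G n).1 ∧
      ∀ s ψ, φ = .all s ψ → ∃ t : Term s, (ψ.inst t).neg ∈ (G n).1 := by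
    intro φ
    obtain ⟨n, rfl⟩ := he φ
    exact ⟨n + 1, ext_dec (G n) (e n)⟩
  -- Every formula is decided at some stage; a negative decision on a derivable formula would make a
  -- later stage inconsistent.
  have closed : ∀ {n φ}, Deriv A (G n).1 φ → ∃ m, φ ∈ (G m).1 := by
    intro n φ h
    obtain ⟨m, hm | ⟨hm, _⟩⟩ := dec φ
    · exact ⟨m, hm⟩
    · exact ((G (max m n)).2 (.impE (.hyp (mono _ _ (le_max_left m n) hm))
        (h.weaken (mono _ _ (le_max_right m n))))).elim
  have cons : ∀ {m n φ}, φ ∈ (G m).1 → φ.neg ∈ (G n).1 → False := by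
    intro m n φ hm hn
    exact (G (max m n)).2 (.impE (.hyp (mono _ _ (le_max_right m n) hn))
      (.hyp (mono _ _ (le_max_left m n) hm)))
  have hT : Henkin A fun φ => ∃ n, φ ∈ (G n).1 := by
    refine ⟨fun ⟨n, hn⟩ => (G n).2 (.hyp hn), fun {φ ψ} => ⟨?_, fun h => ?_⟩,
      fun {s φ} => ⟨fun ⟨n, hn⟩ t => closed (.allE t (.hyp hn)), fun h => ?_⟩,
      fun h => closed (n := 0) (.ax h), fun t => closed (n := 0) (.eqRefl t), ?_⟩
    · rintro ⟨n, hn⟩ ⟨m, hm⟩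
      exact closed (n := max n m) (.impE (.hyp (mono _ _ (le_max_left n m) hn))
        (.hyp (mono _ _ (le_max_right n m) hm)))
    · obtain ⟨n, hn | ⟨hn, _⟩⟩ := dec φ
      · obtain ⟨m, hm⟩ := h ⟨n, hn⟩
        exact closed (n := m) (.impI (.hyp (by simp [hm])))
      · refine closed (n := n) (.impI (.raa ?_))
        exact .impE (.hyp (List.mem_cons_of_mem _ (List.mem_cons_of_mem _ hn)))
          (.hyp (φ := φ) (by simp))
    · obtain ⟨n, hn | ⟨_, hn⟩⟩ := dec (.all s φ)
      · exact ⟨n, hn⟩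
      -- A universal formula that is rejected comes with a rejected instance, contrary to `h`.
      · obtain ⟨t, ht⟩ := hn s φ rfl
        obtain ⟨m, hm⟩ := h t
        exact (cons hm ht).elim
    · rintro φ t u ⟨n, hn⟩ ⟨m, hm⟩
      exact closed (n := max n m) (.eqSubst φ (.hyp (mono _ _ (le_max_left n m) hn))
        (.hyp (mono _ _ (le_max_right n m) hm)))
  obtain ⟨n, hn⟩ := H _ hT
  exact cons (m := n) (n := 0) hn (by simp [G])

/-! ### The numbers of a Henkin theory -/

theorem Sub.single_next (t : Term .num) :
    (fun s i => (Sub.next s i).subst (Sub.single t)) = Sub.single (succ t) := by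
  funext s i
  cases s <;> rcases i with _ | i <;> rfl

theorem Formula.next_inst (φ : Formula) (t : Term .num) :
    (φ.subst Sub.next).inst t = φ.inst (succ t) := by
  rw [Formula.inst, Formula.subst_subst, Sub.single_next, Formula.inst]

/-- Replace number variable `1` by `u` and lower the following ones. -/
def Sub.keepLeft (u : Term .num) : Sub
  | .num, 0 => .nv 0
  | .num, 1 => u.lift .num
  | .num, i + 2 => .nv (i + 1)
  | .fn, i => .fv i

/-- Fixing one of two variables first and filling the other later agrees with filling both at once;
this reduces statements with a parameter to the rules for one variable. -/
theorem Sub.keepLeft_single (t u : Term .num) :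
    (fun s i => (Sub.keepLeft u s i).subst (Sub.single t)) = Sub.double t u := by
  funext s i
  match s, i with
  | .num, 0 => rfl
  | .num, 1 => exact Term.lift_subst_single _ _
  | .num, i + 2 => rfl
  | .fn, i => rfl

/-- Replace number variable `0` by `t` and lower the others. -/
def Sub.keepRight (t : Term .num) : Sub
  | .num, 0 => t.lift .num
  | .num, i + 1 => .nv i
  | .fn, i => .fv i

theorem Sub.keepRight_single (t u : Term .num) :
    (fun s i => (Sub.keepRight t s i).subst (Sub.single u)) = Sub.double t u := by
  funext s i
  match s, i with
  | .num, 0 => exact Term.lift_subst_single _ _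
  | .num, 1 => rfl
  | .num, i + 2 => rfl
  | .fn, i => rfl

@[simp] theorem Term.lift_lift_subst_double {s : Srt} (x : Term s) (t u : Term .num) :
    ((x.lift .num).lift .num).subst (Sub.double t u) = x := by
  simp only [Term.lift, Term.rename_subst]
  conv_rhs => rw [← x.subst_id]
  congr 1
  funext s i
  cases s <;> rfl

theorem Sub.single_cons (t u : Term .num) : (Sub.single t).cons u = Sub.double u t := by
  funext s i
  match s, i with
  | .num, 0 => rfl
  | .num, 1 => rfl
  | .num, i + 2 => rfl
  | .fn, i => rfl

theorem Sub.choice_cons (f : Term .fn) (t : Term .num) :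
    (fun s i => (Sub.choice s i).subst ((Sub.single f).cons t)) = Sub.double (.app f t) t := by
  funext s i
  match s, i with
  | .num, 0 => rfl
  | .num, 1 => rfl
  | .num, i + 2 => rfl
  | .fn, i => rfl

namespace Henkin

variable {T : Formula → Prop} (hT : Henkin RCA₀ T)
-- Leibniz's rule for the formula `s(t) = s(x)` in `x`, whose instance at `t` is reflexivity.
theorem congr_single (hT : Henkin RCA₀ T) (s : Term .num) {t u : Term .num} (h : T (.eq t u)) :
    T (.eq (s.subst (Sub.single t)) (s.subst (Sub.single u))) := by
  have := hT.eqSubst (.eq ((s.subst (Sub.single t)).lift .num) s) h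
  simp only [Formula.inst, Formula.subst, Term.lift_subst_single] at this
  exact this (hT.refl _)

theorem eq_symm (hT : Henkin RCA₀ T) {t u : Term .num} (h : T (.eq t u)) : T (.eq u t) := by
  have := hT.eqSubst (.eq (nv 0) (t.lift .num)) h
  simp only [Formula.inst, Formula.subst, Term.lift_subst_single] at this
  exact this (hT.refl _)

theorem eq_trans (hT : Henkin RCA₀ T) {t u v : Term .num} (h : T (.eq t u)) (h' : T (.eq u v)) : T (.eq t v) := by
  have := hT.eqSubst (.eq (t.lift .num) (nv 0)) h'
  simp only [Formula.inst, Formula.subst, Term.lift_subst_single] at this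
  exact this h

/-- Equality in the theory. -/
def setoid : Setoid (Term .num) :=
  ⟨fun t u => T (.eq t u), hT.refl, hT.eq_symm, hT.eq_trans⟩

/-- The numbers of the term model. -/
def Num : Type := Quotient hT.setoid

/-- The number denoted by a term. -/
def den (t : Term .num) : hT.Num := Quotient.mk hT.setoid t

theorem eq_iff {t u : Term .num} : T (.eq t u) ↔ hT.den t = hT.den u :=
  (Quotient.eq (r := hT.setoid)).symm

theorem exists_den (x : hT.Num) : ∃ t, hT.den t = x := Quotient.exists_rep x

/-- The equality rule replaces one variable at a time, so the arguments are exchanged one after the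
other. -/
theorem den_double (s : Term .num) {t t' u u' : Term .num} (ht : hT.den t = hT.den t')
    (hu : hT.den u = hT.den u') :
    hT.den (s.subst (Sub.double t u)) = hT.den (s.subst (Sub.double t' u')) := by
  have h₁ := hT.congr_single (s.subst (Sub.keepLeft u)) (hT.eq_iff.2 ht)
  have h₂ := hT.congr_single (s.subst (Sub.keepRight t')) (hT.eq_iff.2 hu)
  simp only [Term.subst_subst, Sub.keepLeft_single, Sub.keepRight_single] at h₁ h₂
  exact hT.eq_iff.1 (hT.eq_trans h₁ h₂)

/-- The binary function defined by a term with number variables `0` and `1`. -/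
def map₂ (s : Term .num) : hT.Num → hT.Num → hT.Num :=
  Quotient.map₂ (fun t u => s.subst (Sub.double t u)) fun _ _ ht _ _ hu =>
    hT.eq_iff.2 (hT.den_double s (hT.eq_iff.1 ht) (hT.eq_iff.1 hu))

theorem map₂_den (s t u : Term .num) :
    hT.map₂ s (hT.den t) (hT.den u) = hT.den (s.subst (Sub.double t u)) := rfl

/-- All operations of positive arity on the model come from `map₂`, the unary ones receiving their
argument twice, so that well-definedness is proved only once. -/
instance : Zero hT.Num := ⟨hT.den zero⟩
instance : One hT.Num := ⟨hT.den one⟩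
instance : Add hT.Num := ⟨hT.map₂ (add (nv 0) (nv 1))⟩
instance : Mul hT.Num := ⟨hT.map₂ (mul (nv 0) (nv 1))⟩

/-- The predecessor. -/
def pred (x : hT.Num) : hT.Num := hT.map₂ (RCA.pred (nv 0)) x x

/-- Truncated subtraction. -/
def monus (x y : hT.Num) : hT.Num := hT.map₂ (RCA.monus (nv 0) (nv 1)) x y

/-- Powers of `2`. -/
def twoPow (x : hT.Num) : hT.Num := hT.map₂ (RCA.twoPow (nv 0)) x x

/-- Triangular numbers. -/
def tri (x : hT.Num) : hT.Num := hT.map₂ (RCA.tri (nv 0)) x x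

/-- Triangular roots. -/
def triRoot (x : hT.Num) : hT.Num := hT.map₂ (RCA.triRoot (nv 0)) x x

/-- The value of a function. -/
def app (f : Term .fn) (x : hT.Num) : hT.Num :=
  hT.map₂ (.app ((f.lift .num).lift .num) (nv 0)) x x

theorem den_zero : hT.den zero = 0 := rfl
theorem den_one : hT.den one = 1 := rfl
theorem den_add (t u : Term .num) : hT.den (add t u) = hT.den t + hT.den u := rfl
theorem den_mul (t u : Term .num) : hT.den (mul t u) = hT.den t * hT.den u := rfl
theorem den_pred (t : Term .num) : hT.den (RCA.pred t) = hT.pred (hT.den t) := rfl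
theorem den_monus (t u : Term .num) :
    hT.den (RCA.monus t u) = hT.monus (hT.den t) (hT.den u) := rfl
theorem den_twoPow (t : Term .num) : hT.den (RCA.twoPow t) = hT.twoPow (hT.den t) := rfl
theorem den_triRoot (t : Term .num) : hT.den (RCA.triRoot t) = hT.triRoot (hT.den t) := rfl
theorem den_app (f : Term .fn) (t : Term .num) : hT.den (.app f t) = hT.app f (hT.den t) := by
  rw [app, map₂_den, Term.subst, Term.lift_lift_subst_double]
  rfl

theorem eq_of_ax {t u : Term .num} (h : RCA₀ (.eq t u)) : hT.den t = hT.den u :=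
  hT.eq_iff.1 (hT.ax h)

theorem den_succ (t : Term .num) : hT.den (succ t) = hT.den t + 1 := by
  have h₁ := hT.eq_of_ax (.add_succ t zero)
  have h₂ := hT.den_double (succ (nv 0)) (hT.eq_of_ax (.add_zero t)) (rfl : hT.den zero = _)
  exact (h₁.trans h₂).symm

theorem app_lam (s u : Term .num) :
    hT.app (lam s) (hT.den u) = hT.den (s.subst (Sub.single u)) := by
  rw [← den_app]
  exact hT.eq_of_ax (.beta _ _)

theorem add_zero' (x : hT.Num) : x + 0 = x := by
  obtain ⟨t, rfl⟩ := hT.exists_den x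
  exact hT.eq_of_ax (.add_zero t)

theorem add_succ' (x y : hT.Num) : x + (y + 1) = x + y + 1 := by
  obtain ⟨t, rfl⟩ := hT.exists_den x
  obtain ⟨u, rfl⟩ := hT.exists_den y
  rw [← den_succ, ← den_add, ← den_add, ← den_succ]
  exact hT.eq_of_ax (.add_succ t u)

theorem mul_zero' (x : hT.Num) : x * 0 = 0 := by
  obtain ⟨t, rfl⟩ := hT.exists_den x
  exact hT.eq_of_ax (.mul_zero t)

theorem mul_succ' (x y : hT.Num) : x * (y + 1) = x * y + x := by
  obtain ⟨t, rfl⟩ := hT.exists_den x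
  obtain ⟨u, rfl⟩ := hT.exists_den y
  rw [← den_succ]
  exact hT.eq_of_ax (.mul_succ t u)

theorem succ_ne_zero' (x : hT.Num) : x + 1 ≠ 0 := by
  obtain ⟨t, rfl⟩ := hT.exists_den x
  intro h
  rw [← den_succ, ← den_zero, ← eq_iff] at h
  exact hT.falsum (hT.imp.1 (hT.ax (.succ_ne_zero t)) h)

theorem succ_inj' {x y : hT.Num} (h : x + 1 = y + 1) : x = y := by
  obtain ⟨t, rfl⟩ := hT.exists_den x
  obtain ⟨u, rfl⟩ := hT.exists_den y
  rw [← den_succ, ← den_succ, ← eq_iff] at h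
  exact hT.eq_iff.1 (hT.imp.1 (hT.ax (.succ_inj t u)) h)

theorem den_prec_zero (a b : Term .num) : hT.den (prec a b zero) = hT.den a :=
  hT.eq_of_ax (.prec_zero a b)

theorem den_prec_succ (a b t : Term .num) :
    hT.den (prec a b (succ t)) = hT.map₂ b (hT.den (prec a b t)) (hT.den t) :=
  hT.eq_of_ax (.prec_succ a b t)

/-! ### Definable functions and predicates -/

/-- Binary functions that are defined by a term. -/
def Def (g : hT.Num → hT.Num → hT.Num) : Prop := ∃ s, ∀ x y, hT.map₂ s x y = g x y

/-- Binary predicates that are defined by a quantifier-free formula. -/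
def QF (P : hT.Num → hT.Num → Prop) : Prop :=
  ∃ φ : Formula, φ.QuantifierFree ∧ ∀ t u, T (φ.subst (Sub.double t u)) ↔ P (hT.den t) (hT.den u)

variable {hT}

theorem Def.of_den {g : hT.Num → hT.Num → hT.Num} (s : Term .num)
    (h : ∀ t u, hT.den (s.subst (Sub.double t u)) = g (hT.den t) (hT.den u)) : hT.Def g := by
  refine ⟨s, fun x y => ?_⟩
  obtain ⟨t, rfl⟩ := hT.exists_den x
  obtain ⟨u, rfl⟩ := hT.exists_den y
  exact h t u

theorem Def.den_eq {g : hT.Num → hT.Num → hT.Num} (h : hT.Def g) : ∃ s : Term .num,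
    ∀ t u, hT.den (s.subst (Sub.double t u)) = g (hT.den t) (hT.den u) :=
  ⟨h.choose, fun t u => h.choose_spec (hT.den t) (hT.den u)⟩

theorem Def.fst : hT.Def fun x _ => x := .of_den (nv 0) fun _ _ => rfl

theorem Def.snd : hT.Def fun _ y => y := .of_den (nv 1) fun _ _ => rfl

theorem Def.const (z : hT.Num) : hT.Def fun _ _ => z := by
  obtain ⟨t, rfl⟩ := hT.exists_den z
  exact .of_den ((t.lift .num).lift .num) fun _ _ => by rw [Term.lift_lift_subst_double]

section

variable {g g' : hT.Num → hT.Num → hT.Num}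

theorem Def.add (h : hT.Def g) (h' : hT.Def g') : hT.Def fun x y => g x y + g' x y := by
  obtain ⟨s, hs⟩ := h.den_eq
  obtain ⟨s', hs'⟩ := h'.den_eq
  exact .of_den (.add s s') fun t u => by rw [← hs, ← hs']; rfl

theorem Def.mul (h : hT.Def g) (h' : hT.Def g') : hT.Def fun x y => g x y * g' x y := by
  obtain ⟨s, hs⟩ := h.den_eq
  obtain ⟨s', hs'⟩ := h'.den_eq
  exact .of_den (.mul s s') fun t u => by rw [← hs, ← hs']; rfl

theorem Def.monus (h : hT.Def g) (h' : hT.Def g') :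
    hT.Def fun x y => hT.monus (g x y) (g' x y) := by
  obtain ⟨s, hs⟩ := h.den_eq
  obtain ⟨s', hs'⟩ := h'.den_eq
  exact .of_den (RCA.monus s s') fun t u => by rw [← hs, ← hs']; rfl

theorem Def.pred (h : hT.Def g) : hT.Def fun x y => hT.pred (g x y) := by
  obtain ⟨s, hs⟩ := h.den_eq
  exact .of_den (RCA.pred s) fun t u => by rw [← hs]; rfl

theorem Def.twoPow (h : hT.Def g) : hT.Def fun x y => hT.twoPow (g x y) := by
  obtain ⟨s, hs⟩ := h.den_eq
  exact .of_den (RCA.twoPow s) fun t u => by rw [← hs]; rfl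

theorem Def.tri (h : hT.Def g) : hT.Def fun x y => hT.tri (g x y) := by
  obtain ⟨s, hs⟩ := h.den_eq
  exact .of_den (RCA.tri s) fun t u => by rw [← hs]; rfl

theorem Def.triRoot (h : hT.Def g) : hT.Def fun x y => hT.triRoot (g x y) := by
  obtain ⟨s, hs⟩ := h.den_eq
  exact .of_den (RCA.triRoot s) fun t u => by rw [← hs]; rfl

theorem Def.app (f : Term .fn) (h : hT.Def g) : hT.Def fun x y => hT.app f (g x y) := by
  obtain ⟨s, hs⟩ := h.den_eq
  exact .of_den (.app ((f.lift .num).lift .num) s) fun t u => by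
    rw [← hs, Term.subst, Term.lift_lift_subst_double, den_app]

theorem Def.eq (h : hT.Def g) (h' : hT.Def g') : hT.QF fun x y => g x y = g' x y := by
  obtain ⟨s, hs⟩ := h.den_eq
  obtain ⟨s', hs'⟩ := h'.den_eq
  exact ⟨.eq s s', trivial, fun t u => by rw [Formula.subst, hT.eq_iff, hs, hs']⟩

theorem QF.imp {P Q : hT.Num → hT.Num → Prop} (h : hT.QF P) (h' : hT.QF Q) :
    hT.QF fun x y => P x y → Q x y := by
  obtain ⟨φ, hφ, h⟩ := h
  obtain ⟨ψ, hψ, h'⟩ := h'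
  exact ⟨.imp φ ψ, ⟨hφ, hψ⟩, fun t u => by rw [Formula.subst, hT.imp, h, h']⟩

theorem QF.not {P : hT.Num → hT.Num → Prop} (h : hT.QF P) : hT.QF fun x y => ¬P x y := by
  obtain ⟨φ, hφ, h⟩ := h
  exact ⟨.imp φ .falsum, ⟨hφ, trivial⟩, fun t u => by
    rw [Formula.subst, hT.imp, h]
    exact imp_congr_right fun _ => iff_false_intro hT.falsum⟩

theorem QF.or {P Q : hT.Num → hT.Num → Prop} (h : hT.QF P) (h' : hT.QF Q) :
    hT.QF fun x y => P x y ∨ Q x y := by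
  simpa only [or_iff_not_imp_left] using h.not.imp h'

theorem QF.and {P Q : hT.Num → hT.Num → Prop} (h : hT.QF P) (h' : hT.QF Q) :
    hT.QF fun x y => P x y ∧ Q x y := by
  simpa only [Classical.not_imp, not_not] using (h.imp h'.not).not

/-- The second argument is a parameter. Every later induction in the model must first exhibit its
predicate as quantifier-free, which is what the `Def` and `QF` combinators are for. -/
theorem QF.induction {P : hT.Num → hT.Num → Prop} (h : hT.QF P) (y : hT.Num) (h0 : P 0 y)
    (hs : ∀ x, P x y → P (x + 1) y) (x : hT.Num) : P x y := by
  obtain ⟨φ, hφ, h⟩ := h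
  obtain ⟨t, rfl⟩ := hT.exists_den x
  obtain ⟨u, rfl⟩ := hT.exists_den y
  have key : ∀ t, T ((φ.subst (Sub.keepLeft u)).inst t) ↔ P (hT.den t) (hT.den u) := fun t => by
    rw [Formula.inst, Formula.subst_subst, Sub.keepLeft_single, h]
  refine (key t).1 (hT.all.1 (hT.imp.1 (hT.imp.1 (hT.ax (.ind _ (hφ.subst (Sub.keepLeft u))))
    ((key zero).2 h0)) (hT.all.2 fun t => ?_)) t)
  refine hT.imp.2 fun ht => ?_
  have := (key (succ t)).2 (by rw [den_succ]; exact hs _ ((key t).1 ht))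
  rwa [← Formula.next_inst] at this

end

/-! ### Truth of compound formulas, comprehension and choice -/

theorem T_neg (hT : Henkin RCA₀ T) {φ : Formula} : T φ.neg ↔ ¬T φ := by
  rw [Formula.neg, hT.imp]
  exact imp_congr_right fun _ => iff_false_intro hT.falsum

theorem T_and (hT : Henkin RCA₀ T) {φ ψ : Formula} : T (φ.and ψ) ↔ T φ ∧ T ψ := by
  rw [Formula.and, hT.T_neg, hT.imp, hT.T_neg, Classical.not_imp, not_not]

theorem T_or (hT : Henkin RCA₀ T) {φ ψ : Formula} : T (φ.or ψ) ↔ T φ ∨ T ψ := by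
  rw [Formula.or, hT.imp, hT.T_neg, or_iff_not_imp_left]

theorem T_ex (hT : Henkin RCA₀ T) {s : Srt} {φ : Formula} : T (φ.ex s) ↔ ∃ t : Term s, T (φ.inst t) := by
  rw [Formula.ex, hT.T_neg, hT.all, not_forall]
  refine exists_congr fun t => ?_
  change ¬T (φ.inst t).neg ↔ _
  rw [hT.T_neg, not_not]

theorem Def.exists_fn {g : hT.Num → hT.Num → hT.Num} (h : hT.Def g) (y : hT.Num) :
    ∃ f : Term .fn, ∀ x, hT.app f x = g x y := by
  obtain ⟨s, hs⟩ := h.den_eq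
  obtain ⟨u, rfl⟩ := hT.exists_den y
  refine ⟨lam (s.subst (Sub.keepLeft u)), fun x => ?_⟩
  obtain ⟨t, rfl⟩ := hT.exists_den x
  rw [app_lam, Term.subst_subst, Sub.keepLeft_single, hs]

/-- The value precedes the argument in `P`, because in the axiom the chosen value is number variable
`0`. -/
theorem QF.choice {P : hT.Num → hT.Num → Prop} (h : hT.QF P) (hP : ∀ x, ∃ y, P y x) :
    ∃ f : Term .fn, ∀ x, P (hT.app f x) x := by
  obtain ⟨φ, hφ, h⟩ := h
  have key := hT.imp.1 (hT.ax (.choice φ hφ)) (hT.all.2 fun t => hT.T_ex.2 (by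
    obtain ⟨y, hy⟩ := hP (hT.den t)
    obtain ⟨u, rfl⟩ := hT.exists_den y
    refine ⟨u, ?_⟩
    rw [Formula.subst_up_inst, Sub.single_cons, h]
    exact hy))
  obtain ⟨f, hf⟩ := hT.T_ex.1 key
  refine ⟨f, fun x => ?_⟩
  obtain ⟨t, rfl⟩ := hT.exists_den x
  have := hT.all.1 hf t
  rwa [Formula.subst_up_inst, Formula.subst_subst, Sub.choice_cons, h, den_app] at this

end Henkin

/-! ### The ordered field of differences and fractions of an ordered semiring -/

section Completion

variable (N : Type) [CommSemiring N] [IsCancelAdd N]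

/-- Formal differences `a - b` are written as `a + b ε` with `ε² = 1`; this identifies equal ones. -/
def diffCon : RingCon (QuadraticAlgebra N 1 0) where
  r x y := x.re + y.im = y.re + x.im
  iseqv := ⟨fun _ => rfl, fun h => h.symm, fun {x y z} h h' => by
    refine add_right_cancel (b := y.re + y.im) ?_
    calc _ = (x.re + y.im) + (y.re + z.im) := by ring
      _ = _ := by rw [h, h']; ring⟩
  add' {w x y z} h h' := by
    simp only [QuadraticAlgebra.re_add, QuadraticAlgebra.im_add]
    calc _ = (w.re + x.im) + (y.re + z.im) := by ring
      _ = _ := by rw [h, h']; ring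
  mul' {w x y z} h h' := by
    simp only [QuadraticAlgebra.re_mul, QuadraticAlgebra.im_mul]
    -- There is no subtraction in `N`: these mixed terms are added so that `h` and `h'` can be
    -- applied to complete sums, and are cancelled afterwards.
    refine add_right_cancel (b := x.re * y.im + x.im * y.re) ?_
    calc _ = y.re * (w.re + x.im) + y.im * (x.re + w.im) + x.re * z.im + x.im * z.re := by ring
      _ = y.re * (x.re + w.im) + y.im * (w.re + x.im) + x.re * z.im + x.im * z.re := by rw [h]
      _ = x.re * (y.re + z.im) + x.im * (z.re + y.im) + w.re * y.im + w.im * y.re := by ring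
      _ = x.re * (z.re + y.im) + x.im * (y.re + z.im) + w.re * y.im + w.im * y.re := by rw [h']
      _ = _ := by ring

/-- The ring of differences. -/
def Diff : Type := (diffCon N).Quotient

instance : CommSemiring (Diff N) := inferInstanceAs (CommSemiring (diffCon N).Quotient)

/-- The difference `a - b`. -/
def Diff.mk (a b : N) : Diff N := (diffCon N).mk' ⟨a, b⟩

variable {N}

theorem Diff.mk_eq {a b c d : N} : Diff.mk N a b = Diff.mk N c d ↔ a + d = c + b :=
  (diffCon N).eq

theorem Diff.exists_mk (x : Diff N) : ∃ a b, x = Diff.mk N a b := by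
  obtain ⟨⟨a, b⟩, rfl⟩ := (diffCon N).mk'_surjective x
  exact ⟨a, b, rfl⟩

theorem Diff.mk_add (a b c d : N) : Diff.mk N a b + Diff.mk N c d = Diff.mk N (a + c) (b + d) := by
  rw [Diff.mk, Diff.mk, Diff.mk]
  exact ((diffCon N).mk'.map_add _ _).symm

theorem Diff.mk_mul (a b c d : N) :
    Diff.mk N a b * Diff.mk N c d = Diff.mk N (a * c + b * d) (a * d + b * c) := by
  rw [Diff.mk, Diff.mk, Diff.mk]
  refine ((diffCon N).mk'.map_mul _ _).symm.trans (congrArg _ ?_)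
  ext <;> simp

theorem Diff.mk_zero : Diff.mk N 0 0 = 0 := (diffCon N).mk'.map_zero

theorem Diff.mk_one : Diff.mk N 1 0 = 1 := (diffCon N).mk'.map_one

theorem Diff.exists_neg (x : Diff N) : ∃ y, y + x = 0 := by
  obtain ⟨a, b, rfl⟩ := x.exists_mk
  refine ⟨Diff.mk N b a, ?_⟩
  rw [Diff.mk_add, ← Diff.mk_zero, Diff.mk_eq]
  ring

noncomputable instance : Neg (Diff N) := ⟨fun x => x.exists_neg.choose⟩

noncomputable instance : CommRing (Diff N) where
  zsmul := zsmulRec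
  neg_add_cancel x := x.exists_neg.choose_spec

theorem Diff.neg_mk (a b : N) : -Diff.mk N a b = Diff.mk N b a := by
  rw [neg_eq_iff_add_eq_zero, Diff.mk_add, ← Diff.mk_zero, Diff.mk_eq]
  ring

/-- An ordered semiring with differences embeds into an ordered field of fractions. -/
theorem exists_ordered_field [Nontrivial N] [NoZeroDivisors N]
    (total : ∀ a b : N, ∃ c, a + c = b ∨ b + c = a) (zero : ∀ a b : N, a + b = 0 → a = 0) :
    ∃ (K : Type) (_ : Field K) (_ : LinearOrder K) (_ : IsStrictOrderedRing K) (ι : N →+* K),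
      Function.Injective ι ∧ (∀ n, 0 ≤ ι n) ∧ ∀ x : K, ∃ a b c, c ≠ 0 ∧ x = (ι a - ι b) / ι c := by
  -- Totality makes every difference plus or minus a number; zero divisors and signs of fractions
  -- are thereby reduced to `N`.
  have sign : ∀ x : Diff N, ∃ a, x = Diff.mk N a 0 ∨ x = Diff.mk N 0 a := by
    intro x
    obtain ⟨a, b, rfl⟩ := x.exists_mk
    obtain ⟨c, hc | hc⟩ := total a b
    · refine ⟨c, .inr ?_⟩
      rw [Diff.mk_eq, hc, zero_add]
    · refine ⟨c, .inl ?_⟩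
      rw [Diff.mk_eq, add_comm c, hc, add_zero]
  have mk0 : ∀ a : N, Diff.mk N a 0 = 0 ↔ a = 0 := by
    intro a
    rw [← Diff.mk_zero, Diff.mk_eq]
    simp
  have negmk : ∀ a : N, Diff.mk N 0 a = -Diff.mk N a 0 := fun a => (Diff.neg_mk _ _).symm
  let j : N →+* Diff N :=
    { toFun := fun a => Diff.mk N a 0
      map_zero' := Diff.mk_zero
      map_one' := Diff.mk_one
      map_add' := fun a b => by rw [Diff.mk_add, add_zero]
      map_mul' := fun a b => by rw [Diff.mk_mul]; simp }
  have hj : ∀ a, Diff.mk N a 0 = j a := fun _ => rfl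
  simp only [negmk, hj] at sign mk0
  have : Nontrivial (Diff N) := ⟨0, 1, fun h => one_ne_zero ((mk0 1).1 (by rw [map_one, h]))⟩
  have : NoZeroDivisors (Diff N) := ⟨fun {x y} h => by
    obtain ⟨a, rfl | rfl⟩ := sign x <;> obtain ⟨b, rfl | rfl⟩ := sign y <;>
      simpa [← map_mul, mk0] using h⟩
  have : IsDomain (Diff N) := NoZeroDivisors.to_isDomain _
  let K := FractionRing (Diff N)
  let ι : N →+* K := (algebraMap (Diff N) K).comp j
  have ι0 : ∀ a, ι a = 0 ↔ a = 0 := fun a => by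
    rw [← mk0]
    exact map_eq_zero_iff _ (IsFractionRing.injective (Diff N) K)
  have frac : ∀ x : K, ∃ a b, b ≠ 0 ∧ (x = ι a / ι b ∨ -x = ι a / ι b) := by
    intro x
    obtain ⟨y, z, hz, rfl⟩ := IsFractionRing.div_surjective (A := Diff N) x
    have hz := nonZeroDivisors.ne_zero hz
    have : ∀ a, algebraMap (Diff N) K (j a) = ι a := fun _ => rfl
    obtain ⟨a, rfl | rfl⟩ := sign y <;> obtain ⟨b, rfl | rfl⟩ := sign z <;>
      refine ⟨a, b, fun hb => hz (by simp [hb]), ?_⟩ <;> simp [this, neg_div, div_neg]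
  -- The order is given by its nonnegative cone, the quotients of numbers. If `a / b` and its
  -- negative `c / d` both lie in it, then `a d + c b = 0`, and `zero` forces `a d = 0`.
  let cone : RingCone K :=
    { carrier := {x | ∃ a b, b ≠ 0 ∧ x = ι a / ι b}
      zero_mem' := ⟨0, 1, one_ne_zero, by simp⟩
      one_mem' := ⟨1, 1, one_ne_zero, by simp⟩
      add_mem' := by
        rintro _ _ ⟨a, b, hb, rfl⟩ ⟨c, d, hd, rfl⟩
        refine ⟨a * d + b * c, b * d, mul_ne_zero hb hd, ?_⟩
        rw [div_add_div _ _ (mt (ι0 b).1 hb) (mt (ι0 d).1 hd), map_add, map_mul, map_mul, map_mul]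
      mul_mem' := by
        rintro _ _ ⟨a, b, hb, rfl⟩ ⟨c, d, hd, rfl⟩
        exact ⟨a * c, b * d, mul_ne_zero hb hd, by simp only [map_mul, div_mul_div_comm]⟩
      eq_zero_of_mem_of_neg_mem' := by
        rintro _ ⟨a, b, hb, rfl⟩ ⟨c, d, hd, h⟩
        rw [← neg_div, div_eq_div_iff (mt (ι0 b).1 hb) (mt (ι0 d).1 hd)] at h
        have : ι (a * d + c * b) = 0 := by
          simp only [map_add, map_mul]
          linear_combination -h
        have := zero _ _ ((ι0 _).1 this)
        simp [(mul_eq_zero.1 this).resolve_right hd] }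
  have : HasMemOrNegMem cone := ⟨fun x => by
    obtain ⟨a, b, hb, h | h⟩ := frac x
    exacts [.inl ⟨a, b, hb, h⟩, .inr ⟨a, b, hb, h⟩]⟩
  classical
  let : LinearOrder K := LinearOrder.mkOfAddGroupCone cone
  have : IsOrderedRing K := .mkOfCone cone
  have : IsStrictOrderedRing K := IsOrderedRing.toIsStrictOrderedRing K
  refine ⟨K, inferInstance, inferInstance, inferInstance, ι, ?_, fun n => ?_, fun x => ?_⟩
  · intro a b h
    obtain ⟨c, rfl | rfl⟩ := total a b
    · have : ι c = 0 := by simpa using h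
      rw [(ι0 c).1 this, add_zero]
    · have : ι c = 0 := by simpa using h
      rw [(ι0 c).1 this, add_zero]
  · show ι n - 0 ∈ cone
    exact ⟨n, 1, one_ne_zero, by simp⟩
  · obtain ⟨a, b, hb, h | h⟩ := frac x
    · exact ⟨a, 0, b, hb, by simp [h]⟩
    · refine ⟨0, a, b, hb, ?_⟩
      rw [map_zero, zero_sub, neg_div, ← h, neg_neg]

end Completion

/-! ### The field of limits of quickly converging sequences -/

/-- A class `A` of sequences in an ordered field, indexed by numbers that are possibly nonstandard,
together with the sequence `e` of the powers of `1 / 2`. -/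
structure SeqSpace (N K : Type) [AddCommMonoid N] [Field K] [LinearOrder K]
    [IsStrictOrderedRing K] where
  e : N → K
  -- The index at which `e` is `1 / 2`; `N` is only an additive monoid and has no `1`.
  u : N
  A : Set (N → K)
  e_u : 2 * e u = 1
  e_zero : e 0 = 1
  e_add (m n : N) : e (m + n) = e m * e n
  e_pos (n : N) : 0 < e n
  e_le_one (n : N) : e n ≤ 1
  exists_lt (x : K) : 0 < x → ∃ n, e n < x
  const (x : K) : (fun _ => x) ∈ A
  add {s t : N → K} : s ∈ A → t ∈ A → s + t ∈ A
  mul {s t : N → K} : s ∈ A → t ∈ A → s * t ∈ A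
  neg {s : N → K} : s ∈ A → -s ∈ A
  shift {s : N → K} (m : N) : s ∈ A → (fun k => s (m + k)) ∈ A
  inv {s : N → K} : s ∈ A → (∀ k, s k ≠ 0) → s⁻¹ ∈ A
  -- Reading `s` at `k + k` makes both its own modulus and the allowed error equal to `e k * e k`,
  -- which after taking roots becomes an error of order `e k`.
  sqrt {s : N → K} : s ∈ A → (∀ k, 0 ≤ s k) →
    ∃ t ∈ A, ∀ k, 0 ≤ t k ∧ |t k * t k - s (k + k)| ≤ e k * e k

namespace SeqSpace

variable {N K : Type} [AddCommMonoid N] [Field K] [LinearOrder K] [IsStrictOrderedRing K]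
  (𝒮 : SeqSpace N K)

/-- Sequences that converge with the modulus `2⁻ᵏ`. -/
def Quick (s : N → K) : Prop := ∀ k i, |s k - s (k + i)| ≤ 𝒮.e k

theorem two_mul_e (k : N) : 2 * 𝒮.e (𝒮.u + k) = 𝒮.e k := by
  rw [𝒮.e_add, ← mul_assoc, 𝒮.e_u, one_mul]

theorem e_add_le (m k : N) : 𝒮.e (m + k) ≤ 𝒮.e k := by
  rw [𝒮.e_add]
  exact mul_le_of_le_one_left (𝒮.e_pos k).le (𝒮.e_le_one m)

variable {𝒮} in
theorem Quick.shift {s : N → K} (h : 𝒮.Quick s) (m : N) : 𝒮.Quick fun k => s (m + k) := by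
  intro k i
  have := h (m + k) i
  rw [add_assoc] at this
  exact this.trans (𝒮.e_add_le m k)

variable {𝒮} in
theorem Quick.abs_le {s : N → K} (h : 𝒮.Quick s) (k : N) : |s k| ≤ |s 0| + 1 := by
  have h₁ := h 0 k
  rw [𝒮.e_zero, zero_add, abs_sub_comm] at h₁
  have := abs_add_le (s 0) (s k - s 0)
  rw [add_sub_cancel] at this
  linarith

/-- `2⁻ᵖ B ≤ 1` for some `p`. -/
theorem exists_mul_le (B : K) (hB : 0 < B) : ∃ p, 𝒮.e p * B ≤ 1 := by
  obtain ⟨p, hp⟩ := 𝒮.exists_lt B⁻¹ (inv_pos.2 hB)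
  refine ⟨p, ?_⟩
  have := mul_lt_mul_of_pos_right hp hB
  rw [inv_mul_cancel₀ hB.ne'] at this
  exact this.le

/-- The ring of sequences that converge quickly up to a shift. -/
def S : Subring (N → K) where
  carrier := {s | s ∈ 𝒮.A ∧ ∃ m, 𝒮.Quick fun k => s (m + k)}
  zero_mem' := ⟨𝒮.const 0, 0, fun k _ => by simpa using (𝒮.e_pos k).le⟩
  one_mem' := ⟨𝒮.const 1, 0, fun k _ => by simpa using (𝒮.e_pos k).le⟩
  neg_mem' := by
    rintro s ⟨hs, m, h⟩
    refine ⟨𝒮.neg hs, m, fun k i => ?_⟩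
    have := h k i
    rw [abs_sub_comm] at this
    simpa [neg_add_eq_sub] using this
  add_mem' := by
    rintro s t ⟨hs, m, h⟩ ⟨ht, n, h'⟩
    -- The shifts `m` and `n` make both summands quick, and the additional `u` halves both errors.
    refine ⟨𝒮.add hs ht, m + n + 𝒮.u, fun k i => ?_⟩
    have h₁ := h.shift n (𝒮.u + k) i
    have h₂ := h'.shift m (𝒮.u + k) i
    have h₃ := 𝒮.two_mul_e k
    have e₁ : ∀ j, m + (n + (𝒮.u + j)) = m + n + 𝒮.u + j := fun j => by abel
    have e₂ : ∀ j, n + (m + (𝒮.u + j)) = m + n + 𝒮.u + j := fun j => by abel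
    simp only [add_assoc 𝒮.u, e₁, e₂] at h₁ h₂
    have := abs_add_le (s (m + n + 𝒮.u + k) - s (m + n + 𝒮.u + (k + i)))
      (t (m + n + 𝒮.u + k) - t (m + n + 𝒮.u + (k + i)))
    simp only [Pi.add_apply]
    rw [add_sub_add_comm]
    linarith
  mul_mem' := by
    rintro s t ⟨hs, m, h⟩ ⟨ht, n, h'⟩
    -- The two summands bound the tails of `s` and `t`; shifting by `p` compensates for these
    -- factors.
    obtain ⟨p, hp⟩ := 𝒮.exists_mul_le ((|s (m + 0)| + 1) + (|t (n + 0)| + 1)) (by positivity)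
    refine ⟨𝒮.mul hs ht, m + n + p, fun k i => ?_⟩
    have h₁ := h.shift n (p + k) i
    have h₂ := h'.shift m (p + k) i
    have b₁ := h.abs_le (n + (p + (k + i)))
    have b₂ := h'.abs_le (m + (p + k))
    have e₁ : ∀ j, m + (n + (p + j)) = m + n + p + j := fun j => by abel
    have e₂ : ∀ j, n + (m + (p + j)) = m + n + p + j := fun j => by abel
    simp only [add_assoc p, e₁, e₂, 𝒮.e_add p k] at h₁ h₂ b₁ b₂
    have ek := 𝒮.e_pos k
    have ep := 𝒮.e_pos p
    show |s (m + n + p + k) * t (m + n + p + k) -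
      s (m + n + p + (k + i)) * t (m + n + p + (k + i))| ≤ _
    generalize s (m + n + p + k) = x at *
    generalize s (m + n + p + (k + i)) = x' at *
    generalize t (m + n + p + k) = y at *
    generalize t (m + n + p + (k + i)) = y' at *
    rw [show x * y - x' * y' = (x - x') * y + x' * (y - y') by ring]
    calc |(x - x') * y + x' * (y - y')| ≤ |x - x'| * |y| + |x'| * |y - y'| := by
          rw [← abs_mul, ← abs_mul]; exact abs_add_le _ _
      _ ≤ 𝒮.e p * 𝒮.e k * (|t (n + 0)| + 1) + (|s (m + 0)| + 1) * (𝒮.e p * 𝒮.e k) := by gcongr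
      _ = 𝒮.e p * ((|s (m + 0)| + 1) + (|t (n + 0)| + 1)) * 𝒮.e k := by ring
      _ ≤ 𝒮.e k := mul_le_of_le_one_left ek.le hp

variable {𝒮} in
theorem Quick.mem {s : N → K} (h : 𝒮.Quick s) (hs : s ∈ 𝒮.A) : s ∈ 𝒮.S :=
  ⟨hs, 0, by simpa using h⟩

/-- The ideal of the sequences with limit `0`. -/
def I : Ideal 𝒮.S where
  carrier := {s | ∃ m, ∀ k, |s.1 (m + k)| ≤ 𝒮.e k}
  zero_mem' := ⟨0, fun k => by simpa using (𝒮.e_pos k).le⟩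
  add_mem' := by
    rintro ⟨s, _⟩ ⟨t, _⟩ ⟨m, h⟩ ⟨n, h'⟩
    refine ⟨m + n + 𝒮.u, fun k => ?_⟩
    have h₁ := h (n + (𝒮.u + k))
    have h₂ := h' (m + (𝒮.u + k))
    have h₃ := 𝒮.two_mul_e k
    have h₄ := 𝒮.e_add_le n (𝒮.u + k)
    have h₅ := 𝒮.e_add_le m (𝒮.u + k)
    have e₁ : m + (n + (𝒮.u + k)) = m + n + 𝒮.u + k := by abel
    have e₂ : n + (m + (𝒮.u + k)) = m + n + 𝒮.u + k := by abel
    simp only [e₁, e₂] at h₁ h₂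
    have := abs_add_le (s (m + n + 𝒮.u + k)) (t (m + n + 𝒮.u + k))
    show |s (m + n + 𝒮.u + k) + t (m + n + 𝒮.u + k)| ≤ _
    linarith
  smul_mem' := by
    rintro ⟨s, _, m, h⟩ ⟨t, _⟩ ⟨n, h'⟩
    obtain ⟨p, hp⟩ := 𝒮.exists_mul_le (|s (m + 0)| + 1) (by positivity)
    refine ⟨m + n + p, fun k => ?_⟩
    have h₁ := h.abs_le (n + (p + k))
    have h₂ := (h' (m + (p + k))).trans (𝒮.e_add_le m (p + k))
    have e₁ : m + (n + (p + k)) = m + n + p + k := by abel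
    have e₂ : n + (m + (p + k)) = m + n + p + k := by abel
    rw [𝒮.e_add] at h₂
    simp only [e₁, e₂] at h₁ h₂
    have ek := 𝒮.e_pos k
    show |s (m + n + p + k) * t (m + n + p + k)| ≤ _
    rw [abs_mul]
    calc _ ≤ (|s (m + 0)| + 1) * (𝒮.e p * 𝒮.e k) := by gcongr
      _ = 𝒮.e p * (|s (m + 0)| + 1) * 𝒮.e k := by ring
      _ ≤ 𝒮.e k := mul_le_of_le_one_left ek.le hp

theorem mem_I_of_abs_le {s : 𝒮.S} (h : ∀ k, |s.1 k| ≤ 2 * 𝒮.e k) : s ∈ 𝒮.I :=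
  ⟨𝒮.u, fun k => (h _).trans (𝒮.two_mul_e k).le⟩

theorem shift_mem {s : N → K} (hs : s ∈ 𝒮.S) (n : N) : (fun k => s (n + k)) ∈ 𝒮.S := by
  obtain ⟨hs, m, h⟩ := hs
  refine ⟨𝒮.shift n hs, m, ?_⟩
  simpa only [add_left_comm] using h.shift n

theorem sub_shift_mem (s : 𝒮.S) (n : N) : s - ⟨_, 𝒮.shift_mem s.2 n⟩ ∈ 𝒮.I := by
  obtain ⟨s, hs, m, h⟩ := s
  refine ⟨m, fun k => ?_⟩
  have : |s (m + k) - s (m + (k + n))| ≤ _ := h k n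
  rwa [add_comm k, add_left_comm] at this

/-- The quotient ring. -/
def R : Type := 𝒮.S ⧸ 𝒮.I

noncomputable instance : CommRing 𝒮.R := inferInstanceAs (CommRing (𝒮.S ⧸ 𝒮.I))

/-- The limit of a sequence. -/
def lim : 𝒮.S →+* 𝒮.R := Ideal.Quotient.mk 𝒮.I

theorem lim_eq_lim {s t : 𝒮.S} : 𝒮.lim s = 𝒮.lim t ↔ s - t ∈ 𝒮.I := Ideal.Quotient.eq

theorem lim_eq_zero {s : 𝒮.S} : 𝒮.lim s = 0 ↔ s ∈ 𝒮.I := Ideal.Quotient.eq_zero_iff_mem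

theorem lim_shift (s : 𝒮.S) (n : N) : 𝒮.lim ⟨_, 𝒮.shift_mem s.2 n⟩ = 𝒮.lim s :=
  (𝒮.lim_eq_lim.2 (𝒮.sub_shift_mem s n)).symm

/-- The shift allowed in the definition of `S` can be carried out, since it does not change the
limit. -/
theorem exists_quick (x : 𝒮.R) : ∃ s : 𝒮.S, 𝒮.Quick s.1 ∧ 𝒮.lim s = x := by
  obtain ⟨s, rfl⟩ := Ideal.Quotient.mk_surjective x
  obtain ⟨m, h⟩ := s.2.2
  exact ⟨_, h, 𝒮.lim_shift s m⟩

/-- Quickly converging sequences have the same limit iff they satisfy the inequality of the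
definition of equality of real numbers. -/
theorem lim_eq_lim_iff {s t : 𝒮.S} (hs : 𝒮.Quick s.1) (ht : 𝒮.Quick t.1) :
    𝒮.lim s = 𝒮.lim t ↔ ∀ k, |s.1 k - t.1 k| ≤ 2 * 𝒮.e k := by
  rw [lim_eq_lim]
  refine ⟨fun ⟨m, h⟩ k => le_of_forall_pos_le_add fun ε hε => ?_, fun h => 𝒮.mem_I_of_abs_le h⟩
  -- The sequences are compared at `k + (m + j)`: moving there costs `e k` for each of them, and
  -- their difference there is at most `e j < ε`.
  obtain ⟨j, hj⟩ := 𝒮.exists_lt ε hε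
  have h₁ := h (k + j)
  have h₂ := 𝒮.e_add_le k j
  have h₃ := hs k (m + j)
  have h₄ := ht k (m + j)
  rw [add_left_comm] at h₁
  change |s.1 (k + (m + j)) - t.1 (k + (m + j))| ≤ _ at h₁
  rw [abs_le] at *
  constructor <;> linarith

/-- A nonzero limit is the limit of a sequence that is bounded away from `0`. -/
theorem exists_bounded {x : 𝒮.R} (hx : x ≠ 0) : ∃ s : 𝒮.S, 𝒮.Quick s.1 ∧ 𝒮.lim s = x ∧
    ∃ δ > 0, (∀ k, δ < s.1 k) ∨ ∀ k, δ < -s.1 k := by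
  obtain ⟨s, hs, rfl⟩ := 𝒮.exists_quick x
  -- Such a `k` exists since otherwise the limit would be `0`. Later terms differ from `s k` by at
  -- most `e k`, so they keep its sign and stay farther than `e k` from `0`.
  obtain ⟨k, hk⟩ : ∃ k, 2 * 𝒮.e k < |s.1 k| := by
    by_contra! h
    exact hx (𝒮.lim_eq_zero.2 (𝒮.mem_I_of_abs_le h))
  refine ⟨_, hs.shift k, 𝒮.lim_shift s k, 𝒮.e k, 𝒮.e_pos k, ?_⟩
  rcases lt_abs.1 hk with hk | hk
  · refine .inl fun i => ?_
    have := (abs_le.1 (hs k i)).2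
    show _ < s.1 (k + i)
    linarith
  · refine .inr fun i => ?_
    have := (abs_le.1 (hs k i)).1
    show _ < - s.1 (k + i)
    linarith

theorem not_mem_I {s : 𝒮.S} {δ : K} (hδ : 0 < δ) (h : ∀ k, δ < |s.1 k|) : s ∉ 𝒮.I := by
  rintro ⟨m, hm⟩
  obtain ⟨n, hn⟩ := 𝒮.exists_lt δ hδ
  have := hm n
  have := h (m + n)
  linarith

theorem isField : IsField 𝒮.R where
  exists_pair_ne := ⟨0, 1, fun h => by
    have : (1 : 𝒮.S) ∈ 𝒮.I := 𝒮.lim_eq_zero.1 (by rw [map_one, h])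
    refine 𝒮.not_mem_I (δ := 2⁻¹) (by norm_num) (fun k => ?_) this
    show _ < |(1 : K)|
    norm_num⟩
  mul_comm := mul_comm
  mul_inv_cancel {x} hx := by
    obtain ⟨s, hs, rfl, δ, hδ, h⟩ := 𝒮.exists_bounded hx
    have h : ∀ k, δ < |s.1 k| := fun k => h.elim (fun h => (h k).trans_le (le_abs_self _))
      fun h => (h k).trans_le (neg_le_abs _)
    have h0 : ∀ k, s.1 k ≠ 0 := fun k => abs_pos.1 (hδ.trans (h k))
    have ht : s.1⁻¹ ∈ 𝒮.S := by
      -- The difference of two inverses is the difference of the terms divided by their product,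
      -- which exceeds `δ * δ` in absolute value.
      obtain ⟨p, hp⟩ := 𝒮.exists_mul_le (δ * δ)⁻¹ (by positivity)
      refine ⟨𝒮.inv s.2.1 h0, p, fun k i => ?_⟩
      have h₁ := h (p + k)
      have h₂ := h (p + (k + i))
      have h₃ := hs (p + k) i
      rw [add_assoc, 𝒮.e_add, abs_sub_comm] at h₃
      simp only [Pi.inv_apply]
      rw [inv_sub_inv (h0 _) (h0 _), abs_div, abs_mul]
      have ek := 𝒮.e_pos k
      have ep := 𝒮.e_pos p
      calc _ ≤ 𝒮.e p * 𝒮.e k / (δ * δ) := by gcongr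
        _ = 𝒮.e p * (δ * δ)⁻¹ * 𝒮.e k := by ring
        _ ≤ 𝒮.e k := mul_le_of_le_one_left ek.le hp
    refine ⟨𝒮.lim ⟨_, ht⟩, ?_⟩
    rw [← map_mul, ← map_one 𝒮.lim]
    congr 1
    ext k
    exact mul_inv_cancel₀ (h0 k)

noncomputable instance : Field 𝒮.R where
  __ := (inferInstance : CommRing 𝒮.R)
  __ := 𝒮.isField.toField

/-- A nonzero element has a representative of constant sign, and approximate termwise roots of it,
or of its negative, converge. Zero is treated apart because no sign can be fixed for its
representatives. -/
theorem exists_sqrt (x : 𝒮.R) : ∃ y, y * y = x ∨ y * y = -x := by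
  by_cases hx : x = 0
  · exact ⟨0, by simp [hx]⟩
  have key : ∀ s : 𝒮.S, 𝒮.Quick s.1 → (∀ k, 0 ≤ s.1 k) → ∃ y, y * y = 𝒮.lim s := by
    intro s hs h0
    obtain ⟨t, ht, h⟩ := 𝒮.sqrt s.2.1 h0
    have hq : ∀ k i, |t k - t (k + i)| ≤ 2 * 𝒮.e k := by
      intro k i
      obtain ⟨p₁, h₁⟩ := h k
      obtain ⟨p₂, h₂⟩ := h (k + i)
      have h₃ := hs (k + k) (i + i)
      rw [show k + k + (i + i) = k + i + (k + i) by abel, 𝒮.e_add] at h₃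
      have ek := 𝒮.e_pos k
      have h₄ : 𝒮.e (k + i) ≤ 𝒮.e k := by rw [add_comm]; exact 𝒮.e_add_le i k
      have h₅ : 𝒮.e (k + i) * 𝒮.e (k + i) ≤ 𝒮.e k * 𝒮.e k := by
        have := 𝒮.e_pos (k + i)
        gcongr
      -- One `e k * e k` comes from the variation of `s` and one from each of the two
      -- approximations.
      have h₆ : |t k * t k - t (k + i) * t (k + i)| ≤ 3 * (𝒮.e k * 𝒮.e k) := by
        rw [abs_le] at *
        constructor <;> linarith
      -- For nonnegative numbers the distance is at most the sum. Together with `h₆`, the squared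
      -- distance is at most `3 * (e k * e k)`, which is below the square of `2 * e k`.
      have h₇ : |t k - t (k + i)| * |t k - t (k + i)| ≤ |t k * t k - t (k + i) * t (k + i)| := by
        rw [show t k * t k - t (k + i) * t (k + i) = (t k - t (k + i)) * (t k + t (k + i)) by ring,
          abs_mul]
        refine mul_le_mul_of_nonneg_left ?_ (abs_nonneg _)
        rw [abs_of_nonneg (add_nonneg p₁ p₂), abs_le]
        constructor <;> linarith
      refine abs_le_of_sq_le_sq' ?_ (by positivity) |> abs_le.2
      rw [← sq_abs]
      nlinarith [mul_pos ek ek]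
    have htS : t ∈ 𝒮.S := by
      refine ⟨ht, 𝒮.u, fun k i => ?_⟩
      have := hq (𝒮.u + k) i
      rwa [𝒮.two_mul_e, add_assoc] at this
    refine ⟨𝒮.lim ⟨t, htS⟩, ?_⟩
    rw [← map_mul, lim_eq_lim]
    refine 𝒮.mem_I_of_abs_le fun k => ?_
    have h₁ := (h k).2
    have h₂ := hs k k
    have ek := 𝒮.e_pos k
    have h₃ : 𝒮.e k * 𝒮.e k ≤ 𝒮.e k := mul_le_of_le_one_left ek.le (𝒮.e_le_one k)
    show |t k * t k - s.1 k| ≤ _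
    rw [abs_le] at *
    constructor <;> linarith
  obtain ⟨s, hs, rfl, δ, hδ, h | h⟩ := 𝒮.exists_bounded hx
  · obtain ⟨y, hy⟩ := key s hs fun k => (hδ.trans (h k)).le
    exact ⟨y, .inl hy⟩
  · obtain ⟨y, hy⟩ := key (-s) (fun k i => by
      have := hs k i
      rw [abs_sub_comm] at this
      show |-s.1 k - -s.1 (k + i)| ≤ _
      rwa [neg_sub_neg]) fun k => (hδ.trans (h k)).le
    exact ⟨y, .inr (by rw [hy, map_neg])⟩

/-- If `x ≠ 0`, the terms of the sum stay above some `δ * δ > 0`. Three squares are needed in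
`Cplx.exists_sqrt`, to exclude that `a * a + b * b` is minus a square. -/
theorem eq_zero_of_sq_add_sq_add_sq (x y z : 𝒮.R) (h : x * x + y * y + z * z = 0) : x = 0 := by
  by_contra hx
  obtain ⟨s, -, rfl, δ, hδ, hs⟩ := 𝒮.exists_bounded hx
  obtain ⟨t, -, rfl⟩ := 𝒮.exists_quick y
  obtain ⟨u, -, rfl⟩ := 𝒮.exists_quick z
  simp only [← map_mul, ← map_add] at h
  refine 𝒮.not_mem_I (mul_pos hδ hδ) (fun k => ?_) (𝒮.lim_eq_zero.1 h)
  show _ < |s.1 k * s.1 k + t.1 k * t.1 k + u.1 k * u.1 k|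
  refine lt_of_lt_of_le ?_ (le_abs_self _)
  have : δ * δ < s.1 k * s.1 k := by
    rcases hs with hs | hs
    · nlinarith [hs k]
    · nlinarith [hs k]
  nlinarith [mul_self_nonneg (t.1 k), mul_self_nonneg (u.1 k)]

end SeqSpace

/-! ### Jordan decompositions over a field with square roots -/

/-- Every `2 × 2` matrix over a field with square roots has a Jordan decomposition. -/
theorem exists_jordan {C : Type*} [Field C] (h2 : (2 : C) ≠ 0) (hsq : ∀ z : C, ∃ w, w * w = z)
    (a b c d : C) :
    ∃ u₁ u₂ u₃ u₄ j₁ j₂ j₃ j₄ v₁ v₂ v₃ v₄ : C,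
      ((u₁ * v₁ + u₂ * v₃ = 1 ∧ u₁ * v₂ + u₂ * v₄ = 0) ∧
        (u₃ * v₁ + u₄ * v₃ = 0 ∧ u₃ * v₂ + u₄ * v₄ = 1)) ∧
      ((v₁ * u₁ + v₂ * u₃ = 1 ∧ v₁ * u₂ + v₂ * u₄ = 0) ∧
        (v₃ * u₁ + v₄ * u₃ = 0 ∧ v₃ * u₂ + v₄ * u₄ = 1)) ∧
      (j₃ = 0 ∧ (j₂ = 0 ∨ j₂ = 1 ∧ j₁ = j₄)) ∧
      ((a = (u₁ * j₁ + u₂ * j₃) * v₁ + (u₁ * j₂ + u₂ * j₄) * v₃ ∧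
        b = (u₁ * j₁ + u₂ * j₃) * v₂ + (u₁ * j₂ + u₂ * j₄) * v₄) ∧
        (c = (u₃ * j₁ + u₄ * j₃) * v₁ + (u₃ * j₂ + u₄ * j₄) * v₃ ∧
        d = (u₃ * j₁ + u₄ * j₃) * v₂ + (u₃ * j₂ + u₄ * j₄) * v₄)) := by
  -- It is enough to find `U` and `J` with `M U = U J` and `det U ≠ 0`.
  suffices H : ∃ u₁ u₂ u₃ u₄ j₁ j₂ j₄ : C, u₁ * u₄ - u₂ * u₃ ≠ 0 ∧ (j₂ = 0 ∨ j₂ = 1 ∧ j₁ = j₄) ∧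
      a * u₁ + b * u₃ = u₁ * j₁ ∧ a * u₂ + b * u₄ = u₁ * j₂ + u₂ * j₄ ∧
      c * u₁ + d * u₃ = u₃ * j₁ ∧ c * u₂ + d * u₄ = u₃ * j₂ + u₄ * j₄ by
    obtain ⟨u₁, u₂, u₃, u₄, j₁, j₂, j₄, hD, hj, e₁, e₂, e₃, e₄⟩ := H
    have hD' : (u₁ * u₄ - u₂ * u₃) * (u₁ * u₄ - u₂ * u₃)⁻¹ = 1 := mul_inv_cancel₀ hD
    generalize (u₁ * u₄ - u₂ * u₃)⁻¹ = D at hD'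
    refine ⟨u₁, u₂, u₃, u₄, j₁, j₂, 0, j₄, u₄ * D, -u₂ * D, -u₃ * D, u₁ * D,
      ⟨⟨?_, ?_⟩, ?_, ?_⟩, ⟨⟨?_, ?_⟩, ?_, ?_⟩, ⟨rfl, hj⟩, ⟨?_, ?_⟩, ?_, ?_⟩
    · linear_combination hD'
    · ring
    · ring
    · linear_combination hD'
    · linear_combination hD'
    · ring
    · ring
    · linear_combination hD'
    · linear_combination -a * hD' + u₄ * D * e₁ - u₃ * D * e₂
    · linear_combination -b * hD' - u₂ * D * e₁ + u₁ * D * e₂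
    · linear_combination -c * hD' + u₄ * D * e₃ - u₃ * D * e₄
    · linear_combination -d * hD' - u₂ * D * e₃ + u₁ * D * e₄
  -- A root of the discriminant of the characteristic polynomial; `x` and `y` below are the
  -- eigenvalues, with the trace as sum and the determinant as product.
  obtain ⟨r, hr⟩ := hsq ((a - d) * (a - d) + 4 * b * c)
  obtain ⟨x, hx⟩ : ∃ x, 2 * x = a + d + r := ⟨(a + d + r) / 2, by field_simp⟩
  obtain ⟨y, hy⟩ : ∃ y, 2 * y = a + d - r := ⟨(a + d - r) / 2, by field_simp⟩
  have hxy : x + y = a + d := mul_left_cancel₀ h2 (by linear_combination hx + hy)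
  have hdet : x * y = a * d - b * c := by
    refine mul_left_cancel₀ (mul_ne_zero h2 h2) ?_
    linear_combination hx * (2 * y) + (a + d + r) * hy - hr
  obtain rfl : d = x + y - a := by linear_combination -hxy
  by_cases hb : b = 0
  · subst hb
    by_cases hc : c = 0
    · subst hc
      exact ⟨1, 0, 0, 1, a, 0, x + y - a, by simp, by simp, by ring, by ring, by ring, by ring⟩
    · by_cases h : x = y
      · subst h
        have ha : a = x := by
          have : (a - x) * (a - x) = 0 := by linear_combination hdet
          rw [← sub_eq_zero]; exact mul_self_eq_zero.1 this
        subst ha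
        -- The columns of `U` are the eigenvector `(0, c)` and `(1, 0)`, which `M - a` maps to it.
        exact ⟨0, 1, c, 0, a, 1, a, by simpa using hc, by simp, by ring, by ring, by ring, by ring⟩
      -- `M` is lower triangular, with lower diagonal entry `d = x + y - a`; the columns `(0, 1)`
      -- and `(a - d, c)` are eigenvectors for `d` and `a`.
      · refine ⟨0, a - (x + y - a), 1, c, x + y - a, 0, a, fun h' => h ?_, .inl rfl, by ring,
          by ring, by ring, by ring⟩
        rw [← sub_eq_zero]
        refine mul_self_eq_zero.1 ?_
        linear_combination (-(2 * a - x - y)) * h' - 4 * hdet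
  -- For `b ≠ 0`, an eigenvalue `x` has the eigenvector `(b, x - a)`. If `x` is the only eigenvalue,
  -- `M - x` maps `(0, 1)` to this vector, which gives a block of size two.
  · by_cases h : x = y
    · subst h
      refine ⟨b, 0, x - a, 1, x, 1, x, by simpa using hb, by simp, by ring, by ring, ?_, by ring⟩
      linear_combination hdet
    · refine ⟨b, b, x - a, y - a, x, 0, y, ?_, .inl rfl, by ring, by ring, ?_, ?_⟩
      · have : b * (y - x) ≠ 0 := mul_ne_zero hb (sub_ne_zero.2 (Ne.symm h))
        intro h'; exact this (by linear_combination h')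
      · linear_combination hdet
      · linear_combination hdet

/-! ### Square roots of complex numbers -/

/-- The complex numbers over `R`. -/
abbrev Cplx (R : Type*) [CommRing R] : Type _ := QuadraticAlgebra R (-1) 0

/-- Adjoining `i` to a field of characteristic zero in which every element or its negative is a
square and in which sums of squares vanish only trivially gives square roots. -/
theorem Cplx.exists_sqrt {R : Type*} [Field R] (hsq : ∀ x : R, ∃ y, y * y = x ∨ y * y = -x)
    (hsum : ∀ x y z : R, x * x + y * y + z * z = 0 → x = 0) (z : Cplx R) : ∃ w, w * w = z := by
  have h2 : (2 : R) ≠ 0 := fun h => one_ne_zero (hsum 1 1 0 (by linear_combination h))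
  obtain ⟨a, b⟩ := z
  suffices H : ∃ x y : R, x * x - y * y = a ∧ 2 * x * y = b by
    obtain ⟨x, y, h₁, h₂⟩ := H
    refine ⟨⟨x, y⟩, ?_⟩
    ext
    · simp; linear_combination h₁
    · simp; linear_combination h₂
  by_cases hb : b = 0
  · subst hb
    obtain ⟨y, hy | hy⟩ := hsq a
    · exact ⟨y, 0, by linear_combination hy, by ring⟩
    · exact ⟨0, y, by linear_combination -hy, by ring⟩
  -- The absolute value of `z`, up to sign.
  obtain ⟨r, hr⟩ : ∃ r, r * r = a * a + b * b := by
    obtain ⟨r, hr | hr⟩ := hsq (a * a + b * b)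
    · exact ⟨r, hr⟩
    · exact (hb (hsum b a r (by linear_combination hr))).elim
  -- The usual root has real part `y` with `y² = (r + a) / 2` and imaginary part `b / (2 y)`; the
  -- sign of `r` is left free to make this possible.
  suffices H : ∃ r y : R, r * r = a * a + b * b ∧ 2 * (y * y) = r + a by
    obtain ⟨r, y, hr, hy⟩ := H
    have hy0 : y ≠ 0 := by
      rintro rfl
      exact hb (mul_self_eq_zero.1 (by linear_combination -hr + (a - r) * hy))
    refine ⟨y, b / (2 * y), ?_, by field_simp⟩
    field_simp
    linear_combination (2 * y * y - a + r) * hy + hr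
  obtain ⟨y, hy | hy⟩ := hsq ((r + a) / 2)
  · exact ⟨r, y, hr, by rw [hy]; field_simp⟩
  · have hy' : 2 * (y * y) = -(r + a) := by rw [hy]; field_simp
    have hy0 : y ≠ 0 := by
      rintro rfl
      exact hb (mul_self_eq_zero.1 (by linear_combination -hr + (r - a) * hy'))
    -- Here `y² = -(r + a) / 2`. As `(r + a) (r - a) = b²`, the square of `b / (2 y)` is `(-r + a) /
    -- 2`.
    refine ⟨-r, b / (2 * y), by linear_combination hr, ?_⟩
    field_simp
    linear_combination -hr + (r - a) * hy'

/-- That `-1` is not a square, in the form required by the field structure on `QuadraticAlgebra`. -/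
theorem Cplx.fact_sq {R : Type*} [Field R]
    (hsum : ∀ x y z : R, x * x + y * y + z * z = 0 → x = 0) :
    Fact (∀ r : R, r ^ 2 ≠ -1 + 0 * r) :=
  ⟨fun r h => one_ne_zero (hsum 1 r 0 (by linear_combination h))⟩

namespace Henkin

variable {T : Formula → Prop} {hT : Henkin RCA₀ T}

/-! ### Arithmetic -/

theorem zero_add' (x : hT.Num) : 0 + x = x :=
  QF.induction (P := fun x _ => 0 + x = x) (((Def.const 0).add .fst).eq .fst) 0 (hT.add_zero' 0)
    (fun x ih => by rw [add_succ', ih]) x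

theorem succ_add' (x y : hT.Num) : x + 1 + y = x + y + 1 :=
  QF.induction (P := fun y _ => x + 1 + y = x + y + 1)
    (((Def.const _).add .fst).eq (((Def.const _).add .fst).add (.const _))) 0
    (by rw [add_zero', add_zero']) (fun y ih => by rw [add_succ', add_succ', ih]) y

theorem add_comm' (x y : hT.Num) : x + y = y + x :=
  QF.induction (P := fun y _ => x + y = y + x)
    (((Def.const _).add .fst).eq (Def.add .fst (.const _))) 0
    (by rw [add_zero', zero_add']) (fun y ih => by rw [add_succ', succ_add', ih]) y

theorem add_assoc' (x y z : hT.Num) : x + y + z = x + (y + z) :=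
  QF.induction (P := fun z _ => x + y + z = x + (y + z))
    (((Def.const _).add .fst).eq ((Def.const _).add ((Def.const _).add .fst))) 0
    (by rw [add_zero', add_zero']) (fun z ih => by rw [add_succ', add_succ', add_succ', ih]) z

instance : AddCommMonoid hT.Num where
  add_assoc := add_assoc'
  zero_add := zero_add'
  add_zero := hT.add_zero'
  add_comm := add_comm'
  nsmul := nsmulRec

theorem zero_mul' (x : hT.Num) : 0 * x = 0 :=
  QF.induction (P := fun x _ => 0 * x = 0) (((Def.const 0).mul .fst).eq (.const 0)) 0
    (hT.mul_zero' 0) (fun x ih => by rw [mul_succ', ih, add_zero]) x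

theorem succ_mul' (x y : hT.Num) : (x + 1) * y = x * y + y :=
  QF.induction (P := fun y _ => (x + 1) * y = x * y + y)
    (((Def.const _).mul .fst).eq (((Def.const _).mul .fst).add .fst)) 0
    (by rw [mul_zero', mul_zero', add_zero])
    (fun y ih => by rw [mul_succ', mul_succ', ih]; abel) y

theorem mul_comm' (x y : hT.Num) : x * y = y * x :=
  QF.induction (P := fun y _ => x * y = y * x)
    (((Def.const _).mul .fst).eq (Def.mul .fst (.const _))) 0
    (by rw [mul_zero', zero_mul']) (fun y ih => by rw [mul_succ', succ_mul', ih]) y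

theorem mul_add' (x y z : hT.Num) : x * (y + z) = x * y + x * z :=
  QF.induction (P := fun z _ => x * (y + z) = x * y + x * z)
    (((Def.const _).mul ((Def.const _).add .fst)).eq
      ((Def.const _).add ((Def.const _).mul .fst))) 0
    (by rw [mul_zero', add_zero, add_zero])
    (fun z ih => by rw [← add_assoc, mul_succ', mul_succ', ih, add_assoc]) z

theorem mul_assoc' (x y z : hT.Num) : x * y * z = x * (y * z) :=
  QF.induction (P := fun z _ => x * y * z = x * (y * z))
    (((Def.const _).mul .fst).eq ((Def.const _).mul ((Def.const _).mul .fst))) 0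
    (by rw [mul_zero', mul_zero', mul_zero'])
    (fun z ih => by rw [mul_succ', mul_succ', mul_add', ih]) z

theorem mul_one' (x : hT.Num) : x * 1 = x := by
  rw [← zero_add (1 : hT.Num), mul_succ', mul_zero', zero_add]

instance : CommSemiring hT.Num where
  left_distrib := mul_add'
  right_distrib x y z := by rw [mul_comm', mul_add', mul_comm' z, mul_comm' z]
  zero_mul := zero_mul'
  mul_zero := hT.mul_zero'
  mul_assoc := mul_assoc'
  one_mul x := by rw [mul_comm', mul_one']
  mul_one := mul_one'
  mul_comm := mul_comm'

/-! ### Recursion equations, truncated subtraction and order -/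

theorem pred_zero : hT.pred 0 = 0 := hT.den_prec_zero _ _

theorem pred_succ (x : hT.Num) : hT.pred (x + 1) = x := by
  obtain ⟨t, rfl⟩ := hT.exists_den x
  rw [← den_succ]
  exact hT.den_prec_succ _ _ t

theorem monus_zero (x : hT.Num) : hT.monus x 0 = x := by
  obtain ⟨t, rfl⟩ := hT.exists_den x
  exact hT.den_prec_zero _ _

theorem monus_succ (x y : hT.Num) : hT.monus x (y + 1) = hT.pred (hT.monus x y) := by
  obtain ⟨t, rfl⟩ := hT.exists_den x
  obtain ⟨u, rfl⟩ := hT.exists_den y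
  rw [← den_succ]
  exact hT.den_prec_succ _ _ u

theorem twoPow_zero : hT.twoPow 0 = 1 := hT.den_prec_zero _ _

theorem twoPow_succ (x : hT.Num) : hT.twoPow (x + 1) = hT.twoPow x + hT.twoPow x := by
  obtain ⟨t, rfl⟩ := hT.exists_den x
  rw [← den_succ]
  exact hT.den_prec_succ _ _ t

theorem tri_zero : hT.tri 0 = 0 := hT.den_prec_zero _ _

theorem tri_succ (x : hT.Num) : hT.tri (x + 1) = hT.tri x + (x + 1) := by
  obtain ⟨t, rfl⟩ := hT.exists_den x
  rw [← den_succ]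
  exact hT.den_prec_succ _ _ t

theorem triRoot_zero : hT.triRoot 0 = 0 := hT.den_prec_zero _ _

theorem triRoot_succ (x : hT.Num) : hT.triRoot (x + 1) =
    hT.triRoot x + hT.monus 1 (hT.monus (hT.tri (hT.triRoot x + 1)) (x + 1)) := by
  obtain ⟨t, rfl⟩ := hT.exists_den x
  rw [← den_succ, ← hT.den_triRoot t, ← den_succ]
  exact hT.den_prec_succ _ _ t

theorem eq_zero_or_succ (x : hT.Num) : x = 0 ∨ x = hT.pred x + 1 :=
  QF.induction (P := fun x _ => x = 0 ∨ x = hT.pred x + 1)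
    ((Def.eq .fst (.const 0)).or (Def.eq .fst (Def.fst.pred.add (.const 1)))) 0 (.inl rfl)
    (fun x _ => .inr (by rw [pred_succ])) x

theorem pred_add_one {x : hT.Num} (h : x ≠ 0) : hT.pred x + 1 = x :=
  ((eq_zero_or_succ x).resolve_left h).symm

theorem exists_eq_succ {x : hT.Num} (h : x ≠ 0) : ∃ y, x = y + 1 :=
  ⟨_, (pred_add_one h).symm⟩

/-- The cancellation law for fixed `x` and `y` is itself a quantifier-free implication in `z`, so
induction applies to it. -/
instance : IsCancelAdd hT.Num :=
  haveI : IsRightCancelAdd hT.Num := ⟨fun z x y h =>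
    QF.induction (P := fun z _ => x + z = y + z → x = y)
      (((Def.add (.const x) .fst).eq (Def.add (.const y) .fst)).imp ((Def.const x).eq (.const y))) 0
      (by simp) (fun z ih h => ih (hT.succ_inj' (by rwa [add_assoc, add_assoc]))) z h⟩
  AddCommMagma.IsRightCancelAdd.toIsCancelAdd _

theorem eq_zero_of_add_eq_zero {x y : hT.Num} (h : x + y = 0) : x = 0 := by
  by_contra hx
  obtain ⟨z, rfl⟩ := exists_eq_succ hx
  exact hT.succ_ne_zero' (z + y) (by rw [← h]; ring)

instance : Nontrivial hT.Num := ⟨0, 1, fun h => hT.succ_ne_zero' 0 (by rw [zero_add, h])⟩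

instance : NoZeroDivisors hT.Num := ⟨fun {x y} h => by
  by_contra! hxy
  obtain ⟨z, rfl⟩ := exists_eq_succ hxy.1
  obtain ⟨w, rfl⟩ := exists_eq_succ hxy.2
  exact hT.succ_ne_zero' (z * w + z + w) (by rw [← h]; ring)⟩

/-- Unlike the existence of a difference, this disjunction of equations is quantifier-free and can
be proved by induction; totality of the order is extracted from it. -/
theorem monus_eq_zero_or (x y : hT.Num) : hT.monus x y = 0 ∨ y + hT.monus x y = x :=
  QF.induction (P := fun y _ => hT.monus x y = 0 ∨ y + hT.monus x y = x)
    (((Def.monus (.const x) .fst).eq (.const 0)).or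
      ((Def.add .fst (Def.monus (.const x) .fst)).eq (.const x))) 0
    (.inr (by rw [monus_zero, zero_add])) (fun y ih => by
      rw [monus_succ]
      rcases ih with h | h
      · rw [h, pred_zero]; exact .inl rfl
      · by_cases h0 : hT.monus x y = 0
        · rw [h0, pred_zero]; exact .inl rfl
        · refine .inr ?_
          rw [add_assoc, add_comm 1, pred_add_one h0, h]) y

theorem succ_monus_succ (x y : hT.Num) : hT.monus (x + 1) (y + 1) = hT.monus x y :=
  QF.induction (P := fun y _ => hT.monus (x + 1) (y + 1) = hT.monus x y)
    ((Def.monus (.const _) (Def.fst.add (.const _))).eq (Def.monus (.const _) .fst)) 0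
    (by rw [monus_succ, monus_zero, monus_zero, pred_succ])
    (fun y ih => by rw [monus_succ, ih, monus_succ]) y

theorem add_monus_cancel (x y : hT.Num) : hT.monus (x + y) x = y :=
  QF.induction (P := fun x _ => hT.monus (x + y) x = y)
    ((Def.monus (Def.fst.add (.const _)) .fst).eq (.const _)) 0
    (by rw [monus_zero, zero_add])
    (fun x ih => by rw [add_right_comm, succ_monus_succ, ih]) x

theorem add_monus_of_monus_eq_zero {x y : hT.Num} (h : hT.monus x y = 0) :
    x + hT.monus y x = y :=
  QF.induction (P := fun y _ => hT.monus x y = 0 → x + hT.monus y x = y)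
    (((Def.monus (.const x) .fst).eq (.const 0)).imp
      (((Def.const x).add (Def.fst.monus (.const x))).eq .fst)) 0
    (fun h => by rw [monus_zero] at h; rw [h, monus_zero, zero_add])
    (fun y ih h => by
      by_cases h0 : hT.monus x y = 0
      · have := add_monus_cancel x (hT.monus y x + 1)
        rw [← add_assoc, ih h0] at this
        rw [this, ← add_assoc, ih h0]
      -- The subtraction reaches `0` exactly at this step, so `x = y + 1`.
      · have h₁ := (monus_eq_zero_or x y).resolve_left h0
        rw [monus_succ] at h
        have h₂ := pred_add_one h0
        rw [h, zero_add] at h₂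
        rw [← h₂] at h₁
        have := add_monus_cancel x 0
        rw [add_zero] at this
        rw [h₁, this, add_zero]) y h

theorem monus_eq_zero_iff {x y : hT.Num} : hT.monus x y = 0 ↔ ∃ c, x + c = y := by
  refine ⟨fun h => ⟨_, add_monus_of_monus_eq_zero h⟩, ?_⟩
  rintro ⟨c, rfl⟩
  rcases monus_eq_zero_or x (x + c) with h | h
  · exact h
  · have : c + hT.monus x (x + c) = 0 := by
      refine add_left_cancel (a := x) ?_
      rw [add_zero, ← add_assoc, h]
    rw [add_comm] at this
    exact eq_zero_of_add_eq_zero this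

theorem exists_add_eq_or (x y : hT.Num) : ∃ c, x + c = y ∨ y + c = x := by
  rcases monus_eq_zero_or x y with h | h
  · exact ⟨_, .inl (add_monus_of_monus_eq_zero h)⟩
  · exact ⟨_, .inr h⟩

/-! ### The field of rational numbers -/

variable (hT) in
theorem exists_rat : ∃ (K : Type) (_ : Field K) (_ : LinearOrder K) (_ : IsStrictOrderedRing K)
    (ι : hT.Num →+* K), Function.Injective ι ∧ (∀ n, 0 ≤ ι n) ∧
      ∀ x : K, ∃ a b c, c ≠ 0 ∧ x = (ι a - ι b) / ι c :=
  exists_ordered_field exists_add_eq_or fun _ _ => eq_zero_of_add_eq_zero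

variable (hT) in
/-- The field of rational numbers of the term model. -/
def Rat : Type := hT.exists_rat.choose

noncomputable instance : Field hT.Rat := hT.exists_rat.choose_spec.choose

noncomputable instance : LinearOrder hT.Rat := hT.exists_rat.choose_spec.choose_spec.choose

instance : IsStrictOrderedRing hT.Rat :=
  hT.exists_rat.choose_spec.choose_spec.choose_spec.choose

variable (hT) in
/-- The embedding of the numbers into the rational numbers. -/
noncomputable def ι : hT.Num →+* hT.Rat :=
  hT.exists_rat.choose_spec.choose_spec.choose_spec.choose_spec.choose

theorem ι_injective : Function.Injective hT.ι :=
  hT.exists_rat.choose_spec.choose_spec.choose_spec.choose_spec.choose_spec.1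

theorem ι_nonneg (n : hT.Num) : 0 ≤ hT.ι n :=
  hT.exists_rat.choose_spec.choose_spec.choose_spec.choose_spec.choose_spec.2.1 n

theorem exists_eq_div (x : hT.Rat) : ∃ a b c, c ≠ 0 ∧ x = (hT.ι a - hT.ι b) / hT.ι c :=
  hT.exists_rat.choose_spec.choose_spec.choose_spec.choose_spec.choose_spec.2.2 x

theorem one_le_ι {n : hT.Num} (h : n ≠ 0) : 1 ≤ hT.ι n := by
  obtain ⟨m, rfl⟩ := exists_eq_succ h
  rw [map_add, map_one]
  linarith [ι_nonneg m]

/-- The bridge to the ordered field: inequalities between numbers are quantifier-free, yet can be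
handled by linear arithmetic in `Rat`. -/
theorem monus_eq_zero {x y : hT.Num} : hT.monus x y = 0 ↔ hT.ι x ≤ hT.ι y := by
  rw [monus_eq_zero_iff]
  constructor
  · rintro ⟨c, rfl⟩
    rw [map_add]
    linarith [ι_nonneg c]
  · intro h
    obtain ⟨c, rfl | rfl⟩ := exists_add_eq_or x y
    · exact ⟨c, rfl⟩
    · rw [map_add] at h
      have h0 : hT.ι c = hT.ι 0 := by
        rw [map_zero]
        exact le_antisymm (by linarith) (ι_nonneg c)
      rw [ι_injective h0]
      exact ⟨0, by simp⟩

theorem ι_add_one_le {x y : hT.Num} (h : hT.ι x < hT.ι y) : hT.ι x + 1 ≤ hT.ι y := by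
  obtain ⟨c, rfl | rfl⟩ := exists_add_eq_or x y
  · have hc : c ≠ 0 := by
      rintro rfl
      simp at h
    rw [map_add]
    linarith [one_le_ι hc]
  · rw [map_add] at h
    linarith [ι_nonneg c]

theorem ι_monus {x y : hT.Num} (h : hT.ι y ≤ hT.ι x) : hT.ι (hT.monus x y) = hT.ι x - hT.ι y := by
  rw [eq_sub_iff_add_eq', ← map_add, add_monus_of_monus_eq_zero (monus_eq_zero.2 h)]

theorem Def.ιle {g g' : hT.Num → hT.Num → hT.Num} (h : hT.Def g) (h' : hT.Def g') :
    hT.QF fun x y => hT.ι (g x y) ≤ hT.ι (g' x y) := by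
  simpa only [monus_eq_zero] using (h.monus h').eq (.const 0)

/-! ### Pairing -/

theorem ι_tri_mono {x y : hT.Num} (h : hT.ι x ≤ hT.ι y) : hT.ι (hT.tri x) ≤ hT.ι (hT.tri y) := by
  obtain ⟨c, rfl⟩ := monus_eq_zero_iff.1 (monus_eq_zero.2 h)
  refine QF.induction (P := fun c _ => hT.ι (hT.tri x) ≤ hT.ι (hT.tri (x + c)))
    ((Def.const _).ιle (((Def.const x).add .fst).tri)) 0 (by rw [add_zero]) (fun c ih => ?_) c
  rw [← add_assoc, tri_succ, map_add]
  linarith [ι_nonneg (x + c + 1)]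

theorem triRoot_spec (x : hT.Num) : hT.ι (hT.tri (hT.triRoot x)) ≤ hT.ι x ∧
    hT.ι (x + 1) ≤ hT.ι (hT.tri (hT.triRoot x + 1)) := by
  refine QF.induction (P := fun x _ => hT.ι (hT.tri (hT.triRoot x)) ≤ hT.ι x ∧
    hT.ι (x + 1) ≤ hT.ι (hT.tri (hT.triRoot x + 1)))
    ((Def.fst.triRoot.tri.ιle .fst).and ((Def.fst.add (.const 1)).ιle
      (Def.fst.triRoot.add (.const 1)).tri)) 0 ?_ (fun x ih => ?_) x
  · rw [triRoot_zero, tri_succ, tri_zero, zero_add, zero_add]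
    exact ⟨le_rfl, le_rfl⟩
  · rw [triRoot_succ]
    generalize hT.triRoot x = r at *
    -- The recursion adds `1` exactly when the next triangular number has been reached, since `1 ∸
    -- (tri (r + 1) ∸ (x + 1))` is then `1` and otherwise `0`.
    by_cases h : hT.ι (hT.tri (r + 1)) ≤ hT.ι (x + 1)
    · rw [monus_eq_zero.2 h, monus_zero]
      refine ⟨h, ?_⟩
      rw [tri_succ, map_add hT.ι (hT.tri (r + 1)), map_add hT.ι (x + 1), map_add hT.ι (r + 1)]
      linarith [ih.2, ι_nonneg (r + 1)]
    · have h0 := mt monus_eq_zero.1 h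
      obtain ⟨c, hc⟩ := exists_eq_succ h0
      have h1 : hT.monus 1 (c + 1) = 0 := by
        rw [monus_eq_zero_iff]
        exact ⟨c, add_comm _ _⟩
      rw [hc, h1, add_zero]
      refine ⟨ih.1.trans ?_, ?_⟩
      · rw [map_add, map_one]
        linarith
      · rw [map_add hT.ι (x + 1), map_one]
        exact ι_add_one_le (not_le.1 h)

/-- For `y ≤ w`, the number lies between `tri w` and `tri (w + 1)`, the latter excluded; this makes
the Cantor pairing decodable. -/
theorem triRoot_tri_add {w y : hT.Num} (h : hT.ι y ≤ hT.ι w) : hT.triRoot (hT.tri w + y) = w := by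
  obtain ⟨h₁, h₂⟩ := triRoot_spec (hT.tri w + y)
  generalize hT.triRoot (hT.tri w + y) = r at *
  refine ι_injective (le_antisymm ?_ ?_)
  · by_contra! h'
    have h₃ := ι_add_one_le h'
    have := ι_tri_mono (x := w + 1) (y := r) (by rwa [map_add, map_one])
    rw [tri_succ, map_add, map_add, map_one] at this
    rw [map_add] at h₁
    linarith
  · by_contra! h'
    have h₃ := ι_add_one_le h'
    have := ι_tri_mono (x := r + 1) (y := w) (by rwa [map_add, map_one])
    rw [map_add, map_add, map_one] at h₂
    linarith [ι_nonneg y]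

variable (hT) in
/-- The Cantor pairing. -/
def pair (x y : hT.Num) : hT.Num := hT.tri (x + y) + y

variable (hT) in
/-- The second component of a pair. -/
def right (x : hT.Num) : hT.Num := hT.monus x (hT.tri (hT.triRoot x))

variable (hT) in
/-- The first component of a pair. -/
def left (x : hT.Num) : hT.Num := hT.monus (hT.triRoot x) (hT.right x)

theorem right_pair (x y : hT.Num) : hT.right (hT.pair x y) = y := by
  rw [right, pair, triRoot_tri_add, add_monus_cancel]
  rw [map_add]
  linarith [ι_nonneg x]

theorem left_pair (x y : hT.Num) : hT.left (hT.pair x y) = x := by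
  rw [left, right_pair, pair, triRoot_tri_add, add_comm, add_monus_cancel]
  rw [map_add]
  linarith [ι_nonneg x]

/-! ### Powers of two -/

theorem twoPow_add (x y : hT.Num) : hT.twoPow (x + y) = hT.twoPow x * hT.twoPow y :=
  QF.induction (P := fun y _ => hT.twoPow (x + y) = hT.twoPow x * hT.twoPow y)
    (((Def.const x).add .fst).twoPow.eq ((Def.const _).mul Def.fst.twoPow)) 0
    (by rw [add_zero, twoPow_zero, mul_one])
    (fun y ih => by rw [← add_assoc, twoPow_succ, twoPow_succ, ih, mul_add]) y

theorem add_one_le_ι_twoPow (x : hT.Num) : hT.ι (x + 1) ≤ hT.ι (hT.twoPow x) := by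
  refine QF.induction (P := fun x _ => hT.ι (x + 1) ≤ hT.ι (hT.twoPow x))
    ((Def.fst.add (.const 1)).ιle Def.fst.twoPow) 0 (by rw [zero_add, twoPow_zero])
    (fun x ih => ?_) x
  rw [twoPow_succ, map_add, map_add hT.ι (hT.twoPow x), map_one]
  rw [map_add, map_one] at ih ⊢
  linarith [ι_nonneg x]

variable (hT) in
/-- The rational number `2⁻ⁿ`. -/
noncomputable def e (n : hT.Num) : hT.Rat := (hT.ι (hT.twoPow n))⁻¹

theorem one_le_ι_twoPow (n : hT.Num) : 1 ≤ hT.ι (hT.twoPow n) := by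
  have := add_one_le_ι_twoPow n
  rw [map_add, map_one] at this
  linarith [ι_nonneg n]

theorem e_pos (n : hT.Num) : 0 < hT.e n :=
  inv_pos.2 (zero_lt_one.trans_le (one_le_ι_twoPow n))

theorem e_le_one (n : hT.Num) : hT.e n ≤ 1 := inv_le_one_of_one_le₀ (one_le_ι_twoPow n)

theorem e_zero : hT.e 0 = 1 := by rw [e, twoPow_zero, map_one, inv_one]

theorem e_add (m n : hT.Num) : hT.e (m + n) = hT.e m * hT.e n := by
  rw [e, twoPow_add, map_mul, mul_inv, e, e]

theorem two_mul_e_one : 2 * hT.e 1 = 1 := by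
  have : hT.twoPow 1 = 1 + 1 := by rw [← zero_add 1, twoPow_succ, twoPow_zero, zero_add]
  rw [e, this, map_add, map_one]
  norm_num

/-- That `n < 2ⁿ`. It yields arbitrarily small powers of `1 / 2` and justifies the shift in `rMul`.
-/
theorem e_mul_lt (n : hT.Num) : hT.e n * hT.ι n < 1 := by
  have h := add_one_le_ι_twoPow n
  have h₁ := one_le_ι_twoPow n
  rw [map_add, map_one] at h
  rw [e, inv_mul_lt_iff₀ (by linarith)]
  linarith

/-- Even in a nonstandard model, the rationals are archimedean with respect to the numbers of the
model: the positive part of the numerator is a bound. -/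
theorem exists_le_ι (x : hT.Rat) : ∃ n, x ≤ hT.ι n := by
  obtain ⟨a, b, c, hc, rfl⟩ := exists_eq_div x
  refine ⟨a, ?_⟩
  have := one_le_ι hc
  rw [div_le_iff₀ (by linarith)]
  nlinarith [ι_nonneg a, ι_nonneg b]

theorem exists_e_lt (x : hT.Rat) (hx : 0 < x) : ∃ n, hT.e n < x := by
  obtain ⟨n, hn⟩ := exists_le_ι x⁻¹
  refine ⟨n, ?_⟩
  have h₁ := e_mul_lt n
  have h₂ := mul_le_mul_of_nonneg_left hn (e_pos n).le
  have h₃ : hT.e n * x⁻¹ < 1 := h₂.trans_lt h₁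
  rwa [← div_eq_mul_inv, div_lt_one hx] at h₃

theorem exists_sq_le_lt (m : hT.Num) :
    ∃ n, hT.ι n * hT.ι n ≤ hT.ι m ∧ hT.ι m < (hT.ι n + 1) * (hT.ι n + 1) := by
  by_contra! H
  -- Without an integer square root of `m`, the property `n² ≤ m` would be inductive and hold even
  -- for `n = m + 1`.
  have key := QF.induction (P := fun n _ => hT.ι (n * n) ≤ hT.ι m)
    ((Def.fst.mul .fst).ιle (.const m)) 0 (by rw [mul_zero, map_zero]; exact ι_nonneg m)
    (fun n ih => by
      rw [map_mul, map_add, map_one]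
      exact H n (by rwa [← map_mul])) (m + 1)
  rw [map_mul, map_add, map_one] at key
  nlinarith [ι_nonneg m]

/-- For `x = d / c` and `E = c D`, the number `x E²` is a natural number of the model. Its integer
root `n` gives `q = n / E`, with error at most `(2 q + 1) / E ≤ (2 x + 3) / E ≤ ε`. -/
theorem exists_approx_sqrt {x ε : hT.Rat} (hx : 0 ≤ x) (hε : 0 < ε) :
    ∃ q, 0 ≤ q ∧ |q * q - x| ≤ ε := by
  obtain ⟨D, hD⟩ := exists_le_ι ((2 * x + 3) / ε)
  have hD0 : 0 < hT.ι D := lt_of_lt_of_le (by positivity) hD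
  have hD1 : 1 ≤ hT.ι D := one_le_ι (by rintro rfl; simp at hD0)
  obtain ⟨a, b, c, hc, rfl⟩ := exists_eq_div x
  have hc1 := one_le_ι hc
  have hab : hT.ι b ≤ hT.ι a := by
    by_contra! h
    exact absurd hx (not_le.2 (div_neg_of_neg_of_pos (by linarith) (by linarith)))
  rw [← ι_monus hab] at *
  generalize hT.monus a b = d at *
  obtain ⟨n, h₁, h₂⟩ := exists_sq_le_lt (d * c * (D * D))
  simp only [map_mul] at h₁ h₂
  generalize hT.ι d = d at *
  generalize hT.ι c = c at *
  generalize hT.ι D = D at *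
  have hn := ι_nonneg n
  generalize hT.ι n = n at *
  have hc0 : 0 < c := by linarith
  have hE : D ≤ c * D := le_mul_of_one_le_left hD0.le hc1
  have hE0 : 0 < c * D := by positivity
  have e₁ : d * c * (D * D) = d / c * (c * D * (c * D)) := by field_simp
  rw [e₁] at h₁ h₂
  rw [div_le_iff₀ hε] at hD
  generalize d / c = x at *
  generalize c * D = E at *
  refine ⟨n / E, by positivity, ?_⟩
  have en : n = n / E * E := by field_simp
  have hq : 0 ≤ n / E := by positivity
  generalize n / E = q at *
  subst en
  have h₃ : q * q ≤ x := by
    refine le_of_mul_le_mul_right ?_ (mul_pos hE0 hE0)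
    linarith
  have h₄ : q ≤ x + 1 := by nlinarith
  have h₅ : 2 * x + 3 ≤ E * ε := by
    have := mul_le_mul_of_nonneg_right hE hε.le
    linarith
  rw [abs_of_nonpos (by linarith), neg_sub]
  refine le_of_mul_le_mul_right ?_ (mul_pos hE0 hE0)
  have h₆ := mul_le_mul_of_nonneg_left h₅ hE0.le
  have h₇ := mul_le_mul_of_nonneg_left h₄ hE0.le
  linarith

end Henkin

/-! ### Substitution in the primitive recursive terms -/

section

variable (t u p q : Term .num) (σ : Sub)

@[simp] theorem subst_pred : (pred t).subst σ = pred (t.subst σ) := rfl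

@[simp] theorem subst_monus : (monus t u).subst σ = monus (t.subst σ) (u.subst σ) := rfl

@[simp] theorem subst_twoPow : (twoPow t).subst σ = twoPow (t.subst σ) := rfl

@[simp] theorem subst_tri : (tri t).subst σ = tri (t.subst σ) := rfl

@[simp] theorem subst_triRoot : (triRoot t).subst σ = triRoot (t.subst σ) := rfl

@[simp] theorem subst_pair : (pair t u).subst σ = pair (t.subst σ) (u.subst σ) := by
  simp only [pair, Term.subst, subst_tri]

@[simp] theorem subst_right : (right t).subst σ = right (t.subst σ) := by
  simp only [right, subst_monus, subst_tri, subst_triRoot]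

@[simp] theorem subst_left : (left t).subst σ = left (t.subst σ) := by
  simp only [left, subst_monus, subst_right, subst_triRoot]

@[simp] theorem subst_qMk (a b c : Term .num) :
    (qMk a b c).subst σ = qMk (a.subst σ) (b.subst σ) (c.subst σ) := by
  simp only [qMk, subst_pair]

@[simp] theorem subst_qPos : (qPos q).subst σ = qPos (q.subst σ) := by
  simp only [qPos, subst_left]

@[simp] theorem subst_qNeg : (qNeg q).subst σ = qNeg (q.subst σ) := by
  simp only [qNeg, subst_left, subst_right]

@[simp] theorem subst_qDen : (qDen q).subst σ = qDen (q.subst σ) := by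
  simp only [qDen, Term.subst, subst_right]

@[simp] theorem subst_qAdd : (qAdd p q).subst σ = qAdd (p.subst σ) (q.subst σ) := by
  simp only [qAdd, Term.subst, subst_qMk, subst_qPos, subst_qNeg, subst_qDen, subst_pred]

@[simp] theorem subst_qMul : (qMul p q).subst σ = qMul (p.subst σ) (q.subst σ) := by
  simp only [qMul, Term.subst, subst_qMk, subst_qPos, subst_qNeg, subst_qDen, subst_pred]

@[simp] theorem subst_qOpp : (qOpp q).subst σ = qOpp (q.subst σ) := by
  simp only [qOpp, subst_qMk, subst_qPos, subst_qNeg, subst_right]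

@[simp] theorem subst_qDyadic : (qDyadic t u).subst σ = qDyadic (t.subst σ) (u.subst σ) := by
  simp only [qDyadic, Term.subst, subst_qMk, subst_pred, subst_twoPow]

@[simp] theorem subst_qBound : (qBound q).subst σ = qBound (q.subst σ) := by
  simp only [qBound, Term.subst, subst_qPos, subst_qNeg]

@[simp] theorem subst_qLe : (qLe p q).subst σ = qLe (p.subst σ) (q.subst σ) := by
  simp only [qLe, le, Formula.subst, Term.subst, subst_monus, subst_qPos, subst_qNeg, subst_qDen]

@[simp] theorem subst_and (φ ψ : Formula) : (φ.and ψ).subst σ = (φ.subst σ).and (ψ.subst σ) := rfl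

@[simp] theorem subst_or (φ ψ : Formula) : (φ.or ψ).subst σ = (φ.subst σ).or (ψ.subst σ) := rfl

@[simp] theorem subst_qDistLe (r : Term .num) :
    (qDistLe p q r).subst σ = qDistLe (p.subst σ) (q.subst σ) (r.subst σ) := by
  simp only [qDistLe, subst_and, subst_qLe, subst_qAdd]

end

namespace Henkin

variable {T : Formula → Prop} {hT : Henkin RCA₀ T}

/-! ### Codes of rational numbers -/

/-- The rational number with a given code. -/
noncomputable def val (q : hT.Num) : hT.Rat :=
  (hT.ι (hT.left (hT.left q)) - hT.ι (hT.right (hT.left q))) / hT.ι (hT.right q + 1)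

variable (hT) in
/-- The sum of two codes. -/
def qAdd (p q : hT.Num) : hT.Num := hT.map₂ (RCA.qAdd (nv 0) (nv 1)) p q

variable (hT) in
/-- The product of two codes. -/
def qMul (p q : hT.Num) : hT.Num := hT.map₂ (RCA.qMul (nv 0) (nv 1)) p q

variable (hT) in
/-- The negative of a code. -/
def qOpp (q : hT.Num) : hT.Num := hT.map₂ (RCA.qOpp (nv 0)) q q

variable (hT) in
/-- The code of `m / 2ᵏ`. -/
def qDyadic (m k : hT.Num) : hT.Num := hT.map₂ (RCA.qDyadic (nv 0) (nv 1)) m k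

theorem den_qAdd (p q : Term .num) : hT.den (RCA.qAdd p q) = hT.qAdd (hT.den p) (hT.den q) := rfl
theorem den_qMul (p q : Term .num) : hT.den (RCA.qMul p q) = hT.qMul (hT.den p) (hT.den q) := rfl
theorem den_qOpp (q : Term .num) : hT.den (RCA.qOpp q) = hT.qOpp (hT.den q) := rfl
theorem den_qDyadic (m k : Term .num) :
    hT.den (RCA.qDyadic m k) = hT.qDyadic (hT.den m) (hT.den k) := rfl

theorem den_right (t : Term .num) : hT.den (RCA.right t) = hT.right (hT.den t) := rfl

theorem den_qMk (a b c : Term .num) :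
    hT.den (qMk a b c) = hT.pair (hT.pair (hT.den a) (hT.den b)) (hT.den c) := rfl

theorem den_qPos (q : Term .num) : hT.den (qPos q) = hT.left (hT.left (hT.den q)) := rfl
theorem den_qNeg (q : Term .num) : hT.den (qNeg q) = hT.right (hT.left (hT.den q)) := rfl
theorem den_qDen (q : Term .num) : hT.den (qDen q) = hT.right (hT.den q) + 1 := by
  rw [qDen, den_succ, den_right]

theorem val_pair (a b c : hT.Num) :
    val (hT.pair (hT.pair a b) c) = (hT.ι a - hT.ι b) / hT.ι (c + 1) := by
  rw [val, left_pair, right_pair, left_pair, right_pair]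

theorem ι_add_one_pos (n : hT.Num) : 0 < hT.ι (n + 1) := by
  rw [map_add, map_one]
  linarith [ι_nonneg n]

theorem exists_val (x : hT.Rat) : ∃ q : hT.Num, val q = x := by
  obtain ⟨a, b, c, hc, rfl⟩ := exists_eq_div x
  obtain ⟨d, rfl⟩ := exists_eq_succ hc
  exact ⟨_, val_pair a b d⟩

theorem succ_mul_succ_ne_zero (a b : hT.Num) : (a + 1) * (b + 1) ≠ 0 :=
  mul_ne_zero (hT.succ_ne_zero' a) (hT.succ_ne_zero' b)

theorem val_qAdd (p q : hT.Num) : val (hT.qAdd p q) = val p + val q := by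
  obtain ⟨t, rfl⟩ := hT.exists_den p
  obtain ⟨u, rfl⟩ := hT.exists_den q
  rw [← den_qAdd, RCA.qAdd, den_qMk, val_pair]
  simp only [den_add, den_mul, den_pred, den_qPos, den_qNeg, den_qDen]
  rw [pred_add_one (succ_mul_succ_ne_zero _ _), val, val]
  have h₁ := (ι_add_one_pos (hT.right (hT.den t))).ne'
  have h₂ := (ι_add_one_pos (hT.right (hT.den u))).ne'
  rw [div_add_div _ _ h₁ h₂]
  simp only [map_add hT.ι (_ * _), map_mul]
  congr 1
  ring

theorem val_qMul (p q : hT.Num) : val (hT.qMul p q) = val p * val q := by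
  obtain ⟨t, rfl⟩ := hT.exists_den p
  obtain ⟨u, rfl⟩ := hT.exists_den q
  rw [← den_qMul, RCA.qMul, den_qMk, val_pair]
  simp only [den_add, den_mul, den_pred, den_qPos, den_qNeg, den_qDen]
  rw [pred_add_one (succ_mul_succ_ne_zero _ _), val, val, div_mul_div_comm]
  simp only [map_add hT.ι (_ * _), map_mul]
  congr 1
  ring

theorem val_qOpp (q : hT.Num) : val (hT.qOpp q) = -val q := by
  obtain ⟨u, rfl⟩ := hT.exists_den q
  rw [← den_qOpp, RCA.qOpp, den_qMk, val_pair, den_qPos, den_qNeg, den_right, val, ← neg_div,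
    neg_sub]

theorem val_qDyadic (m k : hT.Num) : val (hT.qDyadic m k) = hT.ι m * hT.e k := by
  obtain ⟨t, rfl⟩ := hT.exists_den m
  obtain ⟨u, rfl⟩ := hT.exists_den k
  have : hT.twoPow (hT.den u) ≠ 0 := fun h => by
    have := one_le_ι_twoPow (hT.den u)
    rw [h, map_zero] at this
    linarith
  rw [← den_qDyadic, RCA.qDyadic, den_qMk, val_pair, den_zero, den_pred, den_twoPow,
    pred_add_one this, map_zero, sub_zero, e, div_eq_mul_inv]

theorem T_qLe {p q : Term .num} : T (qLe p q) ↔ hT.val (hT.den p) ≤ hT.val (hT.den q) := by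
  rw [qLe, le, hT.eq_iff, den_monus, den_zero, monus_eq_zero]
  simp only [den_add, den_mul, den_qPos, den_qNeg, den_qDen]
  rw [val, val, div_le_div_iff₀ (ι_add_one_pos _) (ι_add_one_pos _)]
  simp only [map_add hT.ι (_ * _), map_mul]
  constructor <;> intro h <;> linarith

theorem T_qDistLe {p q r : Term .num} :
    T (qDistLe p q r) ↔ |hT.val (hT.den p) - hT.val (hT.den q)| ≤ hT.val (hT.den r) := by
  rw [qDistLe, hT.T_and, T_qLe (hT := hT), T_qLe (hT := hT), den_qAdd, den_qAdd, val_qAdd, val_qAdd,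
    abs_le]
  constructor <;> rintro ⟨h₁, h₂⟩ <;> constructor <;> linarith

section

variable {g g' : hT.Num → hT.Num → hT.Num}

theorem Def.qAdd (h : hT.Def g) (h' : hT.Def g') : hT.Def fun x y => hT.qAdd (g x y) (g' x y) := by
  obtain ⟨s, hs⟩ := h.den_eq
  obtain ⟨s', hs'⟩ := h'.den_eq
  exact .of_den (RCA.qAdd s s') fun t u => by rw [← hs, ← hs', subst_qAdd, den_qAdd]

theorem Def.qMul (h : hT.Def g) (h' : hT.Def g') : hT.Def fun x y => hT.qMul (g x y) (g' x y) := by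
  obtain ⟨s, hs⟩ := h.den_eq
  obtain ⟨s', hs'⟩ := h'.den_eq
  exact .of_den (RCA.qMul s s') fun t u => by rw [← hs, ← hs', subst_qMul, den_qMul]

theorem Def.qDyadic (h : hT.Def g) (h' : hT.Def g') :
    hT.Def fun x y => hT.qDyadic (g x y) (g' x y) := by
  obtain ⟨s, hs⟩ := h.den_eq
  obtain ⟨s', hs'⟩ := h'.den_eq
  exact .of_den (RCA.qDyadic s s') fun t u => by rw [← hs, ← hs', subst_qDyadic, den_qDyadic]

theorem Def.qOpp (h : hT.Def g) : hT.Def fun x y => hT.qOpp (g x y) := by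
  obtain ⟨s, hs⟩ := h.den_eq
  exact .of_den (RCA.qOpp s) fun t u => by rw [← hs, subst_qOpp, den_qOpp]

theorem Def.valLe (h : hT.Def g) (h' : hT.Def g') :
    hT.QF fun x y => val (g x y) ≤ val (g' x y) := by
  obtain ⟨s, hs⟩ := h.den_eq
  obtain ⟨s', hs'⟩ := h'.den_eq
  refine ⟨qLe s s', trivial, fun t u => ?_⟩
  rw [subst_qLe, T_qLe (hT := hT), hs, hs']

end

/-! ### Sequences -/

variable (hT) in
/-- The sequence of rational numbers given by a function. -/
noncomputable def seq (f : Term .fn) (n : hT.Num) : hT.Rat := val (hT.app f n)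

theorem Def.exists_seq {g : hT.Num → hT.Num → hT.Num} (h : hT.Def g) :
    (fun n => val (g n 0)) ∈ Set.range hT.seq := by
  obtain ⟨f, hf⟩ := h.exists_fn 0
  exact ⟨f, funext fun n => by rw [seq, hf]⟩

variable (hT) in
/-- The sequences of rational numbers that are given by functions of the term model. -/
noncomputable def seqSpace : SeqSpace hT.Num hT.Rat where
  e := hT.e
  u := 1
  A := Set.range hT.seq
  e_u := two_mul_e_one
  e_zero := e_zero
  e_add := e_add
  e_pos := e_pos
  e_le_one := e_le_one
  exists_lt := exists_e_lt
  const x := by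
    obtain ⟨q, rfl⟩ := exists_val x
    exact (Def.const q).exists_seq
  add := by
    rintro _ _ ⟨f, rfl⟩ ⟨g, rfl⟩
    have := (((Def.fst (hT := hT)).app f).qAdd (Def.fst.app g)).exists_seq
    simp only [val_qAdd] at this
    exact this
  mul := by
    rintro _ _ ⟨f, rfl⟩ ⟨g, rfl⟩
    have := (((Def.fst (hT := hT)).app f).qMul (Def.fst.app g)).exists_seq
    simp only [val_qMul] at this
    exact this
  neg := by
    rintro _ ⟨f, rfl⟩
    have := ((Def.fst (hT := hT)).app f).qOpp.exists_seq
    simp only [val_qOpp] at this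
    exact this
  shift := by
    rintro _ m ⟨f, rfl⟩
    exact (((Def.const m).add .fst).app f).exists_seq
  inv := by
    rintro _ ⟨f, rfl⟩ h0
    obtain ⟨c, hc⟩ := exists_val (1 : hT.Rat)
    -- Different codes may have the same value, so equality of values is expressed by two
    -- inequalities; choice then picks a code of each inverse.
    have hP := ((Def.fst.qMul (Def.snd.app f)).valLe (.const c)).and
      ((Def.const c).valLe (Def.fst.qMul (Def.snd.app f)))
    simp only [← le_antisymm_iff, val_qMul, hc] at hP
    obtain ⟨g, hg⟩ := hP.choice fun x => by
      obtain ⟨y, hy⟩ := exists_val (hT.seq f x)⁻¹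
      exact ⟨y, by rw [hy]; exact inv_mul_cancel₀ (h0 x)⟩
    exact ⟨g, funext fun x => eq_inv_of_mul_eq_one_left (hg x)⟩
  sqrt := by
    rintro _ ⟨f, rfl⟩ h0
    obtain ⟨c, hc⟩ := exists_val (0 : hT.Rat)
    have hf : hT.Def fun _ x => hT.app f (x + x) := (Def.snd.add .snd).app f
    have hd : hT.Def fun _ x => hT.qDyadic 1 (x + x) := (Def.const 1).qDyadic (Def.snd.add .snd)
    -- The condition `0 ≤ q` and `|q² - f(2x)| ≤ 2⁻²ˣ`, with the absolute value split into two
    -- inequalities.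
    have hP := ((Def.const c).valLe .fst).and
      (((Def.fst.qMul .fst).valLe (hf.qAdd hd)).and (hf.valLe ((Def.fst.qMul .fst).qAdd hd)))
    simp only [val_qAdd, val_qMul, val_qDyadic, map_one, one_mul, hc, e_add] at hP
    obtain ⟨g, hg⟩ := hP.choice fun x => by
      obtain ⟨q, hq, h⟩ := exists_approx_sqrt (h0 (x + x)) (mul_pos (e_pos x) (e_pos x))
      obtain ⟨y, rfl⟩ := exists_val q
      rw [abs_le] at h
      exact ⟨y, hq, by simp only [seq] at h; linarith, by simp only [seq] at h; linarith⟩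
    refine ⟨_, ⟨g, rfl⟩, fun k => ⟨(hg k).1, ?_⟩⟩
    obtain ⟨-, h₁, h₂⟩ := hg k
    rw [abs_le]
    constructor <;> simp only [seq] <;> linarith

end Henkin

/-! ### Substitution in the formulas about real and complex numbers -/

section

variable (f g : Term .fn) (σ : Sub)

@[simp] theorem subst_isReal : (isReal f).subst σ = isReal (f.subst σ) := by
  simp only [isReal, Formula.subst, subst_qDistLe, Term.subst, Term.lift_subst_up, subst_qDyadic]
  rfl

@[simp] theorem subst_rEq : (rEq f g).subst σ = rEq (f.subst σ) (g.subst σ) := by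
  simp only [rEq, Formula.subst, subst_qDistLe, Term.subst, Term.lift_subst_up, subst_qDyadic]
  rfl

@[simp] theorem subst_rZero : rZero.subst σ = rZero := by
  simp only [rZero, Term.subst, subst_qMk]

@[simp] theorem subst_rOne : rOne.subst σ = rOne := by
  simp only [rOne, Term.subst, subst_qMk, one]

@[simp] theorem subst_rAdd : (rAdd f g).subst σ = rAdd (f.subst σ) (g.subst σ) := by
  simp only [rAdd, Term.subst, Term.lift_subst_up, subst_qAdd]
  rfl

@[simp] theorem subst_rOpp : (rOpp f).subst σ = rOpp (f.subst σ) := by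
  simp only [rOpp, Term.subst, Term.lift_subst_up, subst_qOpp]
  rfl

@[simp] theorem subst_rMul : (rMul f g).subst σ = rMul (f.subst σ) (g.subst σ) := by
  simp only [rMul, Term.subst, Term.lift_subst_up, subst_qMul, subst_qBound, one]
  rfl

/-- Substitution in a complex number. -/
def CTerm.subst (z : CTerm) (σ : Sub) : CTerm := ⟨z.re.subst σ, z.im.subst σ⟩

/-- Substitution in a matrix. -/
def MTerm.subst (A : MTerm) (σ : Sub) : MTerm :=
  ⟨A.a.subst σ, A.b.subst σ, A.c.subst σ, A.d.subst σ⟩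

variable (z w : CTerm) (A B : MTerm)

@[simp] theorem subst_isComplex : (isComplex z).subst σ = isComplex (z.subst σ) := by
  simp only [isComplex, subst_and, subst_isReal, CTerm.subst]

@[simp] theorem subst_cEq : (cEq z w).subst σ = cEq (z.subst σ) (w.subst σ) := by
  simp only [cEq, subst_and, subst_rEq, CTerm.subst]

@[simp] theorem subst_cZero : cZero.subst σ = cZero := by
  simp only [cZero, CTerm.subst, subst_rZero]

@[simp] theorem subst_cOne : cOne.subst σ = cOne := by
  simp only [cOne, CTerm.subst, subst_rZero, subst_rOne]

@[simp] theorem subst_cAdd : (cAdd z w).subst σ = cAdd (z.subst σ) (w.subst σ) := by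
  simp only [cAdd, CTerm.subst, subst_rAdd]

@[simp] theorem subst_cMul : (cMul z w).subst σ = cMul (z.subst σ) (w.subst σ) := by
  simp only [cMul, CTerm.subst, subst_rAdd, subst_rMul, subst_rOpp]

@[simp] theorem subst_isMatrix : (isMatrix A).subst σ = isMatrix (A.subst σ) := by
  simp only [isMatrix, subst_and, subst_isComplex, MTerm.subst]

@[simp] theorem subst_mEq : (mEq A B).subst σ = mEq (A.subst σ) (B.subst σ) := by
  simp only [mEq, subst_and, subst_cEq, MTerm.subst]

@[simp] theorem subst_mOne : mOne.subst σ = mOne := by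
  simp only [mOne, MTerm.subst, subst_cZero, subst_cOne]

@[simp] theorem subst_mMul : (mMul A B).subst σ = mMul (A.subst σ) (B.subst σ) := by
  simp only [mMul, MTerm.subst, subst_cAdd, subst_cMul]

@[simp] theorem subst_isInverse : (isInverse A B).subst σ = isInverse (A.subst σ) (B.subst σ) := by
  simp only [isInverse, subst_and, subst_mEq, subst_mMul, subst_mOne]

@[simp] theorem subst_isJordan : (isJordan A).subst σ = isJordan (A.subst σ) := by
  simp only [isJordan, subst_and, subst_or, subst_cEq, subst_cZero, subst_cOne, MTerm.subst]

end

/-- Assign `e 0, …, e (n - 1)` to the function variables `0, …, n - 1`. -/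
def Sub.consFn (σ : Sub) : ℕ → (ℕ → Term .fn) → Sub
  | 0, _ => σ
  | n + 1, e => (σ.consFn n fun i => e (i + 1)).cons (e 0)

namespace Henkin

variable {T : Formula → Prop} {hT : Henkin RCA₀ T}

/-- As `allFn (n + 1) φ` is `allFn n (all .fn φ)`, the induction hypothesis handles the outer
quantifiers and the remaining innermost one takes `e 0`. -/
theorem T_allFn (hT : Henkin RCA₀ T) {n : ℕ} {φ : Formula} {σ : Sub}
    (h : ∀ e, T (φ.subst (σ.consFn n e))) : T ((allFn n φ).subst σ) := by
  induction n generalizing φ with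
  | zero => exact h fun _ => rZero
  | succ n ih =>
    refine ih fun e => hT.all.2 fun t => ?_
    rw [Formula.subst_up_inst]
    exact h fun i => i.casesOn t e

theorem T_exFn (hT : Henkin RCA₀ T) {n : ℕ} {φ : Formula} {σ : Sub} (e : ℕ → Term .fn)
    (h : T (φ.subst (σ.consFn n e))) : T ((exFn n φ).subst σ) := by
  induction n generalizing φ e with
  | zero => exact h
  | succ n ih =>
    refine ih (fun i => e (i + 1)) (hT.T_ex.2 ⟨e 0, ?_⟩)
    rwa [Formula.subst_up_inst]

/-! ### Real numbers -/

theorem T_isReal {f : Term .fn} : T (isReal f) ↔ hT.seqSpace.Quick (hT.seq f) := by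
  have key : ∀ t u, T (qDistLe (.app f t) (.app f (add t u)) (RCA.qDyadic one t)) ↔
      |hT.seq f (hT.den t) - hT.seq f (hT.den t + hT.den u)| ≤ hT.e (hT.den t) := by
    intro t u
    rw [T_qDistLe (hT := hT), den_app, den_app, den_qDyadic, val_qDyadic, den_one, map_one, one_mul]
    rfl
  have h : T (isReal f) ↔ ∀ t u, T (qDistLe (.app f t) (.app f (add t u)) (RCA.qDyadic one t)) := by
    rw [isReal, hT.all]
    refine forall_congr' fun t => ?_
    rw [Formula.inst, Formula.subst, hT.all]
    refine forall_congr' fun u => ?_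
    rw [Formula.subst_up_inst, Sub.single_cons]
    simp only [subst_qDistLe, Term.subst, Term.lift_lift_subst_double, subst_qDyadic]
    rfl
  rw [h]
  refine ⟨fun h k i => ?_, fun h t u => (key t u).2 (h _ _)⟩
  obtain ⟨t, rfl⟩ := hT.exists_den k
  obtain ⟨u, rfl⟩ := hT.exists_den i
  exact (key t u).1 (h t u)

theorem T_rEq {f g : Term .fn} :
    T (rEq f g) ↔ ∀ k, |hT.seq f k - hT.seq g k| ≤ 2 * hT.e k := by
  have key : ∀ t, T (qDistLe (.app f t) (.app g t) (RCA.qDyadic (succ one) t)) ↔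
      |hT.seq f (hT.den t) - hT.seq g (hT.den t)| ≤ 2 * hT.e (hT.den t) := by
    intro t
    rw [T_qDistLe (hT := hT), den_app, den_app, den_qDyadic, val_qDyadic, den_succ, den_one,
      map_add, map_one, one_add_one_eq_two]
    rfl
  have h : T (rEq f g) ↔ ∀ t, T (qDistLe (.app f t) (.app g t) (RCA.qDyadic (succ one) t)) := by
    rw [rEq, hT.all]
    refine forall_congr' fun t => ?_
    rw [Formula.inst]
    simp only [subst_qDistLe, Term.subst, Term.lift_subst_single, subst_qDyadic]
    rfl
  rw [h]
  refine ⟨fun h k => ?_, fun h t => (key t).2 (h _)⟩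
  obtain ⟨t, rfl⟩ := hT.exists_den k
  exact (key t).1 (h t)

theorem seq_lam (s t : Term .num) :
    hT.seq (lam s) (hT.den t) = val (hT.den (s.subst (Sub.single t))) := by
  rw [seq, app_lam]

theorem seq_rAdd (f g : Term .fn) (k : hT.Num) :
    hT.seq (rAdd f g) k = hT.seq f (1 + k) + hT.seq g (1 + k) := by
  obtain ⟨t, rfl⟩ := hT.exists_den k
  rw [rAdd, seq_lam]
  simp only [subst_qAdd, Term.subst, Term.lift_subst_single, den_qAdd, val_qAdd, den_app, den_succ]
  rw [add_comm 1]
  rfl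

theorem seq_rOpp (f : Term .fn) (k : hT.Num) : hT.seq (rOpp f) k = -hT.seq f k := by
  obtain ⟨t, rfl⟩ := hT.exists_den k
  rw [rOpp, seq_lam]
  simp only [subst_qOpp, Term.subst, Term.lift_subst_single, den_qOpp, val_qOpp, den_app]
  rfl

theorem seq_rZero (k : hT.Num) : hT.seq rZero k = 0 := by
  obtain ⟨t, rfl⟩ := hT.exists_den k
  rw [rZero, seq_lam]
  simp only [subst_qMk, Term.subst, den_qMk, val_pair, sub_self, zero_div]

theorem seq_rOne (k : hT.Num) : hT.seq rOne k = 1 := by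
  obtain ⟨t, rfl⟩ := hT.exists_den k
  rw [rOne, seq_lam]
  simp only [subst_qMk, one, Term.subst, den_qMk, val_pair, den_succ, den_zero]
  simp

theorem abs_val_le (q : Term .num) : |hT.val (hT.den q)| ≤ hT.ι (hT.den (qBound q)) := by
  rw [qBound, den_add, den_qPos, den_qNeg, val, map_add, map_add, map_one]
  have h₁ := ι_nonneg (hT.left (hT.left (hT.den q)))
  have h₂ := ι_nonneg (hT.right (hT.left (hT.den q)))
  have h₃ := ι_nonneg (hT.right (hT.den q))
  generalize hT.ι _ = a at *
  generalize hT.ι _ = b at *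
  generalize hT.ι _ = c at *
  rw [abs_div, abs_of_nonneg (show 0 ≤ c + 1 by linarith), div_le_iff₀ (by linarith), abs_le]
  constructor <;> nlinarith

theorem seq_rMul (f g : Term .fn) : ∃ m : hT.Num,
    |hT.seq f 0| + |hT.seq g 0| + 2 ≤ hT.ι m ∧
      ∀ k, hT.seq (rMul f g) k = hT.seq f (m + k) * hT.seq g (m + k) := by
  refine ⟨hT.den (add (add (qBound (.app f zero)) (qBound (.app g zero))) (succ one)), ?_,
    fun k => ?_⟩
  · have h₁ := abs_val_le (hT := hT) (.app f zero)
    have h₂ := abs_val_le (hT := hT) (.app g zero)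
    rw [den_app] at h₁ h₂
    rw [den_add, den_add, den_succ, den_one, map_add, map_add, map_add hT.ι 1, map_one]
    rw [seq, seq]
    rw [den_zero] at h₁ h₂
    linarith
  · obtain ⟨t, rfl⟩ := hT.exists_den k
    rw [rMul, seq_lam]
    simp only [subst_qMul, Term.subst, Term.lift_subst_single, den_qMul, val_qMul, den_app,
      subst_qBound, one]
    rfl

/-- The real number `f` of the theory denotes the element `x` of the field of limits. -/
def Rep (f : Term .fn) (x : hT.seqSpace.R) : Prop :=
  ∃ h : hT.seq f ∈ hT.seqSpace.S, hT.seqSpace.Quick (hT.seq f) ∧ hT.seqSpace.lim ⟨_, h⟩ = x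

section

variable {f g : Term .fn} {x y : hT.seqSpace.R}

theorem Rep.isReal (h : Rep f x) : T (isReal f) := (T_isReal (hT := hT)).2 h.2.1

theorem exists_rep_of_isReal (h : T (RCA.isReal f)) : ∃ x : hT.seqSpace.R, Rep f x :=
  have hq := (T_isReal (hT := hT)).1 h
  ⟨_, hq.mem ⟨f, rfl⟩, hq, rfl⟩

theorem exists_rep (x : hT.seqSpace.R) : ∃ f, Rep f x := by
  obtain ⟨⟨_, ⟨f, rfl⟩, h⟩, hs, rfl⟩ := hT.seqSpace.exists_quick x
  exact ⟨f, ⟨⟨f, rfl⟩, h⟩, hs, rfl⟩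

theorem Rep.rEq_iff (h : Rep f x) (h' : Rep g y) : T (rEq f g) ↔ x = y := by
  obtain ⟨hf, qf, rfl⟩ := h
  obtain ⟨hg, qg, rfl⟩ := h'
  rw [T_rEq (hT := hT), SeqSpace.lim_eq_lim_iff _ qf qg]
  rfl

/-- A quickly converging sequence that is a shift of `s` represents the limit of `s`. -/
theorem Rep.of_shift {s : hT.seqSpace.S} (m : hT.Num) (h : ∀ k, hT.seq f k = s.1 (m + k))
    (hq : hT.seqSpace.Quick (hT.seq f)) : Rep f (hT.seqSpace.lim s) := by
  refine ⟨hq.mem ⟨f, rfl⟩, hq, ?_⟩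
  rw [← hT.seqSpace.lim_shift s m]
  congr 2
  exact funext h

theorem Rep.rZero : Rep (hT := hT) rZero 0 := by
  rw [← map_zero hT.seqSpace.lim]
  refine .of_shift 0 seq_rZero fun k i => ?_
  rw [seq_rZero, seq_rZero, sub_self, abs_zero]
  exact (e_pos k).le

theorem Rep.rOne : Rep (hT := hT) rOne 1 := by
  rw [← map_one hT.seqSpace.lim]
  refine .of_shift 0 seq_rOne fun k i => ?_
  rw [seq_rOne, seq_rOne, sub_self, abs_zero]
  exact (e_pos k).le

theorem Rep.rAdd (h : Rep f x) (h' : Rep g y) : Rep (rAdd f g) (x + y) := by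
  obtain ⟨hf, qf, rfl⟩ := h
  obtain ⟨hg, qg, rfl⟩ := h'
  rw [← map_add]
  -- The shift by `1` in `rAdd` halves both errors, so the sum is again quick without a further
  -- shift.
  refine .of_shift 1 (seq_rAdd f g) fun k i => ?_
  have h₁ := qf (1 + k) i
  have h₂ := qg (1 + k) i
  have h₃ := hT.seqSpace.two_mul_e k
  change 2 * hT.seqSpace.e (1 + k) = _ at h₃
  rw [seq_rAdd, seq_rAdd, ← add_assoc]
  rw [abs_le] at *
  constructor <;> linarith

theorem Rep.rOpp (h : Rep f x) : Rep (rOpp f) (-x) := by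
  obtain ⟨hf, qf, rfl⟩ := h
  rw [← map_neg]
  refine .of_shift 0 (fun k => by rw [seq_rOpp, zero_add]; rfl) fun k i => ?_
  have := qf k i
  rw [seq_rOpp, seq_rOpp, neg_sub_neg, abs_sub_comm]
  exact this

/-- The errors of the factors at `m + k` are multiplied by at most `|f(0)| + |g(0)| + 2 ≤ m < 2ᵐ`,
so the shift by `m` restores the modulus `2⁻ᵏ`. -/
theorem Rep.rMul (h : Rep f x) (h' : Rep g y) : Rep (rMul f g) (x * y) := by
  obtain ⟨hf, qf, rfl⟩ := h
  obtain ⟨hg, qg, rfl⟩ := h'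
  obtain ⟨m, hm, hs⟩ := seq_rMul (hT := hT) f g
  rw [← map_mul]
  refine .of_shift m hs fun k i => ?_
  have h₁ := qf (m + k) i
  have h₂ := qg (m + k) i
  have b₁ := qf.abs_le (m + (k + i))
  have b₂ := qg.abs_le (m + k)
  rw [hs, hs]
  rw [add_assoc] at h₁ h₂
  have hp : hT.e m * hT.ι m ≤ 1 := (e_mul_lt m).le
  change _ ≤ hT.e (m + k) at h₁ h₂
  show _ ≤ hT.e k
  rw [e_add] at h₁ h₂
  have em := e_pos m
  have ek := e_pos k
  generalize hT.seq f (m + k) = a at *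
  generalize hT.seq f (m + (k + i)) = a' at *
  generalize hT.seq g (m + k) = b at *
  generalize hT.seq g (m + (k + i)) = b' at *
  rw [show a * b - a' * b' = (a - a') * b + a' * (b - b') by ring]
  calc |(a - a') * b + a' * (b - b')| ≤ |a - a'| * |b| + |a'| * |b - b'| := by
        rw [← abs_mul, ← abs_mul]; exact abs_add_le _ _
    _ ≤ hT.e m * hT.e k * (|hT.seq g 0| + 1) + (|hT.seq f 0| + 1) * (hT.e m * hT.e k) := by gcongr
    _ = hT.e m * hT.e k * (|hT.seq f 0| + |hT.seq g 0| + 2) := by ring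
    _ ≤ hT.e m * hT.e k * hT.ι m := by gcongr
    _ = hT.e m * hT.ι m * hT.e k := by ring
    _ ≤ hT.e k := mul_le_of_le_one_left ek.le hp

end

/-! ### Complex numbers and matrices -/

/-- The complex number `z` of the theory denotes `x`. -/
def CRep (z : CTerm) (x : Cplx hT.seqSpace.R) : Prop := Rep z.re x.re ∧ Rep z.im x.im

section

variable {z w : CTerm} {x y : Cplx hT.seqSpace.R}

theorem CRep.isComplex (h : CRep z x) : T (isComplex z) := hT.T_and.2 ⟨h.1.isReal, h.2.isReal⟩

theorem exists_crep_of_isComplex (h : T (RCA.isComplex z)) : ∃ x : Cplx hT.seqSpace.R, CRep z x := by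
  obtain ⟨h₁, h₂⟩ := hT.T_and.1 h
  obtain ⟨a, ha⟩ := exists_rep_of_isReal (hT := hT) h₁
  obtain ⟨b, hb⟩ := exists_rep_of_isReal (hT := hT) h₂
  exact ⟨⟨a, b⟩, ha, hb⟩

theorem CRep.cEq_iff (h : CRep z x) (h' : CRep w y) : T (cEq z w) ↔ x = y := by
  rw [cEq, hT.T_and, h.1.rEq_iff h'.1, h.2.rEq_iff h'.2, QuadraticAlgebra.ext_iff]

theorem CRep.cZero : CRep (hT := hT) cZero 0 := ⟨.rZero, .rZero⟩

theorem CRep.cOne : CRep (hT := hT) cOne 1 := ⟨.rOne, .rZero⟩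

theorem CRep.cAdd (h : CRep z x) (h' : CRep w y) : CRep (cAdd z w) (x + y) :=
  ⟨h.1.rAdd h'.1, h.2.rAdd h'.2⟩

theorem CRep.cMul (h : CRep z x) (h' : CRep w y) : CRep (cMul z w) (x * y) := by
  constructor
  · have := (h.1.rMul h'.1).rAdd (h.2.rMul h'.2).rOpp
    have e : (x * y).re = x.re * y.re + -(x.im * y.im) := by
      rw [QuadraticAlgebra.re_mul]
      ring
    rwa [e]
  · have := (h.1.rMul h'.2).rAdd (h.2.rMul h'.1)
    have e : (x * y).im = x.re * y.im + x.im * y.re := by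
      rw [QuadraticAlgebra.im_mul]
      ring
    rwa [e]

end

/-- The matrix `A` of the theory denotes the matrix with the entries `a`, `b`, `c`, `d`. -/
def MRep (A : MTerm) (a b c d : Cplx hT.seqSpace.R) : Prop :=
  (CRep A.a a ∧ CRep A.b b) ∧ (CRep A.c c ∧ CRep A.d d)

section

variable {A B : MTerm} {a b c d a' b' c' d' : Cplx hT.seqSpace.R}

theorem MRep.isMatrix (h : MRep A a b c d) : T (isMatrix A) :=
  hT.T_and.2 ⟨hT.T_and.2 ⟨h.1.1.isComplex, h.1.2.isComplex⟩,
    hT.T_and.2 ⟨h.2.1.isComplex, h.2.2.isComplex⟩⟩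

theorem exists_mrep_of_isMatrix (h : T (RCA.isMatrix A)) :
    ∃ a b c d : Cplx hT.seqSpace.R, MRep A a b c d := by
  obtain ⟨h₁, h₂⟩ := hT.T_and.1 h
  obtain ⟨ha, hb⟩ := hT.T_and.1 h₁
  obtain ⟨hc, hd⟩ := hT.T_and.1 h₂
  obtain ⟨a, ha⟩ := exists_crep_of_isComplex (hT := hT) ha
  obtain ⟨b, hb⟩ := exists_crep_of_isComplex (hT := hT) hb
  obtain ⟨c, hc⟩ := exists_crep_of_isComplex (hT := hT) hc
  obtain ⟨d, hd⟩ := exists_crep_of_isComplex (hT := hT) hd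
  exact ⟨a, b, c, d, ⟨ha, hb⟩, hc, hd⟩

theorem MRep.mEq_iff (h : MRep A a b c d) (h' : MRep B a' b' c' d') :
    T (mEq A B) ↔ (a = a' ∧ b = b') ∧ (c = c' ∧ d = d') := by
  rw [mEq, hT.T_and, hT.T_and, hT.T_and, h.1.1.cEq_iff h'.1.1, h.1.2.cEq_iff h'.1.2,
    h.2.1.cEq_iff h'.2.1, h.2.2.cEq_iff h'.2.2]

theorem MRep.mOne : MRep (hT := hT) mOne 1 0 0 1 := ⟨⟨.cOne, .cZero⟩, .cZero, .cOne⟩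

theorem MRep.mMul (h : MRep A a b c d) (h' : MRep B a' b' c' d') :
    MRep (mMul A B) (a * a' + b * c') (a * b' + b * d') (c * a' + d * c') (c * b' + d * d') :=
  ⟨⟨(h.1.1.cMul h'.1.1).cAdd (h.1.2.cMul h'.2.1), (h.1.1.cMul h'.1.2).cAdd (h.1.2.cMul h'.2.2)⟩,
    (h.2.1.cMul h'.1.1).cAdd (h.2.2.cMul h'.2.1), (h.2.1.cMul h'.1.2).cAdd (h.2.2.cMul h'.2.2)⟩

theorem MRep.isJordan_iff (h : MRep A a b c d) :
    T (isJordan A) ↔ c = 0 ∧ (b = 0 ∨ b = 1 ∧ a = d) := by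
  rw [isJordan, hT.T_and, hT.T_or, hT.T_and, h.2.1.cEq_iff .cZero, h.1.2.cEq_iff .cZero,
    h.1.2.cEq_iff .cOne, h.1.1.cEq_iff h.2.2]

end

/-! ### The sentence in a Henkin theory -/

theorem T_jordanSentence (hT : Henkin RCA₀ T) : T jordanSentence := by
  rw [← jordanSentence.subst_id]
  refine hT.T_allFn fun e => hT.imp.2 fun hM => ?_
  rw [subst_isMatrix] at hM
  obtain ⟨a, b, c, d, hM⟩ := exists_mrep_of_isMatrix (hT := hT) hM
  have hsum := hT.seqSpace.eq_zero_of_sq_add_sq_add_sq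
  have := Cplx.fact_sq hsum
  obtain ⟨u₁, u₂, u₃, u₄, j₁, j₂, j₃, j₄, v₁, v₂, v₃, v₄, hUV, hVU, hJ, hMU⟩ :=
    exists_jordan (C := Cplx hT.seqSpace.R)
      (fun h => one_ne_zero (hsum 1 1 0 (by
        have := congrArg QuadraticAlgebra.re h
        simp only [QuadraticAlgebra.re_ofNat, QuadraticAlgebra.re_zero] at this
        linear_combination this)))
      (Cplx.exists_sqrt hT.seqSpace.exists_sqrt hsum) a b c d
  choose F hF using exists_rep (hT := hT)
  let E : List (Cplx hT.seqSpace.R) := [u₁, u₂, u₃, u₄, j₁, j₂, j₃, j₄, v₁, v₂, v₃, v₄]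
  -- Real and imaginary parts alternate as in `mVar`, and the entries of `U`, `J`, `V` occupy the
  -- places from `0`, `8` and `16` on. The default `rZero` is never reached.
  let e' : List (Term .fn) := E.flatMap fun x => [F x.re, F x.im]
  refine hT.T_exFn (fun i => e'.getD i rZero) ?_
  simp only [subst_and, subst_isMatrix, subst_isInverse, subst_isJordan, subst_mEq, subst_mMul]
  generalize hU : (mVar 0).subst _ = U
  generalize hJ' : (mVar 8).subst _ = J
  generalize hV : (mVar 16).subst _ = V
  generalize hM' : (mVar 24).subst _ = M
  have rU : MRep U u₁ u₂ u₃ u₄ := by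
    subst hU
    exact ⟨⟨⟨hF _, hF _⟩, ⟨hF _, hF _⟩⟩, ⟨hF _, hF _⟩, ⟨hF _, hF _⟩⟩
  have rJ : MRep J j₁ j₂ j₃ j₄ := by
    subst hJ'
    exact ⟨⟨⟨hF _, hF _⟩, ⟨hF _, hF _⟩⟩, ⟨hF _, hF _⟩, ⟨hF _, hF _⟩⟩
  have rV : MRep V v₁ v₂ v₃ v₄ := by
    subst hV
    exact ⟨⟨⟨hF _, hF _⟩, ⟨hF _, hF _⟩⟩, ⟨hF _, hF _⟩, ⟨hF _, hF _⟩⟩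
  -- The variables from `24` on skip the 24 new values, so they are the original entries of the
  -- matrix.
  have rM : MRep M a b c d := by
    subst hM'
    exact hM
  rw [isInverse, hT.T_and, hT.T_and, hT.T_and, hT.T_and, hT.T_and, hT.T_and,
    (rU.mMul rV).mEq_iff .mOne, (rV.mMul rU).mEq_iff .mOne, rJ.isJordan_iff,
    rM.mEq_iff ((rU.mMul rJ).mMul rV)]
  exact ⟨⟨rU.isMatrix, rJ.isMatrix, rV.isMatrix⟩, ⟨hUV, hVU⟩, hJ, hMU⟩

end Henkin

end RCA

theorem mainTheorem8 : RCA.Provable RCA.RCA₀ RCA.jordanSentence :=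
  RCA.Provable.of_henkin (fun _ h σ => h.subst σ) fun _ hT => hT.T_jordanSentence
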